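/- **Language.** $\lambda^A$ is the affine, call-by-value $\lambda$-calculus with types $1$, $\mathbb N$, a base type $A$ of keys, $\otimes$, $\multimap$, the lazy product $\&$, $!^k_c\,\tau$ ($k\in\{1,2,\dots,\infty\}$ uses of a $\tau$, carrying $c$ credits, $c$ a finite sum of constants and credit variables), $\exists\alpha.\tau$ ($\alpha$ a credit variable) and $\mathrm{tree}\,\tau$, where a tree is $\mathrm{Emp}$ or $N(x,m,l,r)$ with a label $x:\tau$, a cached size $m:\mathbb N$ and subtrees $l,r$. The keys are the elements of an arbitrary linear order $K$, with a primitive case distinction on $x\le y$. Judgments $\Gamma\vdash_f M:\tau$ carry a resource term $f$ (credits in the bank, permitted uses of each variable). Besides the usual introduction and elimination forms there are $\mathtt{tick}$, $\mathtt{create}_c$, $\mathtt{spend}_c$, $\mathtt{save}^k_c$, $\mathtt{transfer}$, $\mathtt{pack}$, $\mathtt{unpack}$, a recursor on $\mathbb N$, and a recursor on trees which matches two levels (empty tree; node with no child, only a left child, only a right child, two children) and offers each subtree two levels down, lazily paired with the recursive call on it. Branches that a recursor may repeat have type $!^\infty_0(\cdots)$. **Extraction.** $\|M\|=(\|M\|_c,\|M\|_p)$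 is the recurrence extracted from $M$: its amortized cost and its potential. The type of potentials erases $!^k_c$, turns $\sigma\multimap\tau$ into $\sigma\to\mathbb C\times\tau$, $\sigma\mathbin{\&}\tau$ into $(\mathbb C\times\sigma)\times(\mathbb C\times\tau)$ and $\exists\alpha.\tau$ into $\$\times\tau$, where $\mathbb C$ is the type of costs and $\$$ that of credit amounts; $\mathtt{tick}$ adds $1$ to the cost, $\mathtt{create}_c$ adds $c$, $\mathtt{spend}_c$ subtracts $c$, $\mathtt{save}^k_c$ multiplies by $k$, and the elimination forms of $\otimes$ and $!$ multiply the cost of the term that they eliminate by the multiplicity with which it is used. **Semantics.** $[\![\cdot]\!]$ interprets types as posets with a greatest element $\infty$ and binary maxima, and terms as monotone maps. Costs are $\mathbb Z\cup\{\infty\}$ with its usual order, with $\infty\cdot c=0$ if $c\le0$ and $\infty\cdot c=\infty$ otherwise. Numbers, credit amounts and keys are the flat posets $\mathbb N\cup\{\infty\}$, $\mathbb N\cup\{\infty\}$, $K\cup\{\infty\}$, in which distinct elements below $\infty$ are incomparable. Products and functions are the products and the posets of monotone functions with the pointwise order. Trees are the labelled trees, those of the same shape compared node by node, with an element $\infty$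 adjoined at every level. Recursors compute the recursion exactly on elements built from constructors and give $\infty$ where the matched levels are not so built; a comparison with a key $\infty$ gives the maximum of both branches. **Program.** Let $T=\mathrm{tree}(\exists\alpha.\,!^\infty_\alpha A)$ and $\varphi(n)=\lceil\lg(n+1)\rceil$, also written $\varphi$ as a function on $\mathbb N\cup\{\infty\}$ with $\varphi(\infty)=\infty$. The function $\mathtt{size}:T\multimap\mathbb N\otimes T$ returns the cached size ($0$ for $\mathrm{Emp}$) and rebuilds the tree; below, $[\![\|\mathtt{size}(t)\|_p]\!]$ stands for its first component. The function $\mathtt{split}:\,!^\infty_0A\otimes T\multimap T\otimes T$, defined by the tree recursor, separates the keys less than a pivot $p$ from the others. In each of the following cases the call incurs one $\mathtt{tick}$; $x$ is the key at the root. * $\mathtt{split}(p,\mathrm{Emp})=(\mathrm{Emp},\mathrm{Emp})$. * If $p\le x$ and the left subtree is empty, the result is $(\mathrm{Emp},t)$. If $p\le x$ and $t=N(x,N(y,a,b),c)$: if $p\le y$, it is $(s,N(y,g,N(x,b,c)))$ with $(s,g)=\mathtt{split}(p,a)$; otherwise it is $(N(y,a,s),N(x,g,c))$ with $(s,g)=\mathtt{split}(p,b)$.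 * If $p>x$ and the right subtree is empty, the result is $(t,\mathrm{Emp})$. If $p>x$ and $t=N(x,c,N(z,a,b))$: if $p\le z$, it is $(N(x,c,s),N(z,g,b))$ with $(s,g)=\mathtt{split}(p,a)$; otherwise it is $(N(z,N(x,c,a),s),g)$ with $(s,g)=\mathtt{split}(p,b)$. In the four cases with a recursive call, the credits stored with the two visited keys are spent, the size $m$ of each of the two new nodes is computed from the sizes of its subtrees and cached there, and $\varphi(m)$ credits are created and stored with its key. Everything else, including the cached sizes and the credits, is left unchanged. The code that computes $\varphi$, reads and adds sizes, and creates a variable number of credits contains no $\mathtt{tick}$. For a tree $t$ and a key $v$, $\mathtt{split}(t,v)$ denotes $\mathtt{split}$ applied to the pivot $v$ and to $t$. **Splay trees.** A splay tree of size $n$ is a closed well-typed value $t:T$ (typed with any number of credits in the bank) with $n$ nodes which is a binary search tree (at each node with key $x$, the keys of the left subtree are $\le x$ and those of the right subtree are $\ge x$) such that each node whose subtree has $m$ nodes caches the size $m$ and stores exactly $\varphi(m)$ credits with its key; the stored amounts are read off $[\![\|t\|_p]\!]$, where such a node is $N((\alpha,x),m,\dots)$ with $\alpha=\varphi(m)$.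 **Theorem.** For every linear order $K$ of keys, every splay tree $t$ of size $n$ and every key $v\in K$, $$[\![\|\mathtt{size}(t)\|_p]\!]=n\qquad\text{and}\qquad [\![\|\mathtt{split}(t,v)\|_c]\!]\;\le\;1+2\varphi\bigl([\![\|\mathtt{size}(t)\|_p]\!]\bigr)=1+2\varphi(n).$$ Moreover $1+2\varphi(n)\in O(\lg n)$ as $n\to\infty$. -/

import Mathlib

/-! # Posets with a top element and binary maxima -/

namespace SplayCost

/-- A poset with a top element and binary maxima. -/
structure Dom where
  carrier : Type
  [sup : SemilatticeSup carrier]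
  [top : OrderTop carrier]

attribute [instance] Dom.sup Dom.top

/-- The flat poset on `X`: the elements of `X`, pairwise incomparable, and `inf` (that is, `∞`)
above all of them. -/
inductive Flat (X : Type) where
  | val (x : X)
  | inf

namespace Flat

instance instPartialOrder {X : Type} : PartialOrder (Flat X) where
  le s t := t = inf ∨ s = t
  le_refl s := Or.inr rfl
  le_trans s t u h1 h2 := by
    rcases h2 with rfl | rfl
    · exact Or.inl rfl
    · exact h1
  le_antisymm s t h1 h2 := by
    rcases h1 with rfl | rfl
    · rcases h2 with rfl | h2
      · rfl
      · exact h2.symm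
    · rfl

theorem le_def {X : Type} (s t : Flat X) : s ≤ t ↔ t = inf ∨ s = t := Iff.rfl

instance instOrderTop {X : Type} : OrderTop (Flat X) where
  top := inf
  le_top _ := Or.inl rfl

def join {X : Type} [DecidableEq X] : Flat X → Flat X → Flat X
  | val x, val y => if x = y then val x else inf
  | _, _ => inf

instance instSemilatticeSup {X : Type} [DecidableEq X] : SemilatticeSup (Flat X) where
  sup := join
  le_sup_left s t := by
    cases s <;> cases t <;> simp [join, le_def, eq_comm, em']
  le_sup_right s t := by
    cases s <;> cases t <;> simp [join, le_def]
    split_ifs with h <;> simp [h]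
  sup_le s t u h1 h2 := by
    cases s <;> cases t <;> cases u <;> simp_all [join, le_def]

/-- Pointwise extension of a function, with `∞` sent to `∞`. -/
def map {X Y : Type} (f : X → Y) : Flat X →o Flat Y where
  toFun
    | val x => val (f x)
    | inf => inf
  monotone' s t h := by
    rcases h with rfl | rfl
    · exact Or.inl rfl
    · exact le_rfl

/-- Pointwise extension of a binary function, with `∞` absorbing. -/
def map₂ {X Y Z : Type} (f : X → Y → Z) : Flat X × Flat Y →o Flat Z where
  toFun
    | (val x, val y) => val (f x y)
    | _ => inf
  monotone' := by
    rintro ⟨s, t⟩ ⟨s', t'⟩ ⟨h1, h2⟩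
    rcases h1 with rfl | rfl
    · exact Or.inl (by cases t' <;> rfl)
    · rcases h2 with rfl | rfl
      · exact Or.inl (by cases s <;> rfl)
      · exact le_rfl

/-- Monotone extension of a function on `X` to the flat poset, with `∞` sent to `∞`. -/
def lift {X C : Type} [Preorder C] [OrderTop C] (f : X → C) : Flat X →o C where
  toFun
    | val x => f x
    | inf => ⊤
  monotone' s t h := by
    rcases h with rfl | rfl
    · exact le_top
    · exact le_rfl

end Flat

/-- Trees with labels in `α` and cached sizes in `β`, with a top element `inf` adjoined at every
level. -/
inductive TreeDom (α β : Type) where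
  | inf
  | emp
  | node (a : α) (n : β) (l r : TreeDom α β)

namespace TreeDom

variable {α β : Type}

/-- Trees of the same shape are compared label by label; `inf` is above everything. -/
def le [LE α] [LE β] : TreeDom α β → TreeDom α β → Prop
  | _, inf => True
  | emp, emp => True
  | node a n l r, node a' n' l' r' => a ≤ a' ∧ n ≤ n' ∧ le l l' ∧ le r r'
  | _, _ => False

theorem le_refl' [Preorder α] [Preorder β] (s : TreeDom α β) : le s s := by
  induction s with
  | inf => trivial
  | emp => trivial
  | node a n l r hl hr => exact ⟨le_rfl, le_rfl, hl, hr⟩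

theorem le_trans' [Preorder α] [Preorder β] (s t u : TreeDom α β) (h1 : le s t) (h2 : le t u) :
    le s u := by
  induction u generalizing s t with
  | inf => cases s <;> trivial
  | emp => cases t <;> cases s <;> simp_all [le]
  | node a n l r hl hr =>
    cases t <;> cases s <;> simp only [le] at h1 h2 ⊢
    exact ⟨h1.1.trans h2.1, h1.2.1.trans h2.2.1, hl _ _ h1.2.2.1 h2.2.2.1,
      hr _ _ h1.2.2.2 h2.2.2.2⟩

theorem le_antisymm' [PartialOrder α] [PartialOrder β] (s t : TreeDom α β) (h1 : le s t)
    (h2 : le t s) : s = t := by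
  induction s generalizing t with
  | inf => cases t <;> simp_all [le]
  | emp => cases t <;> simp_all [le]
  | node a n l r hl hr =>
    cases t <;> simp only [le] at h1 h2
    rw [h1.1.antisymm h2.1, h1.2.1.antisymm h2.2.1, hl _ h1.2.2.1 h2.2.2.1,
      hr _ h1.2.2.2 h2.2.2.2]

instance instPartialOrder [PartialOrder α] [PartialOrder β] : PartialOrder (TreeDom α β) where
  le := le
  le_refl := le_refl'
  le_trans := le_trans'
  le_antisymm := le_antisymm'

instance instOrderTop [PartialOrder α] [PartialOrder β] : OrderTop (TreeDom α β) where
  top := inf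
  le_top s := by cases s <;> trivial

def join [Max α] [Max β] : TreeDom α β → TreeDom α β → TreeDom α β
  | emp, emp => emp
  | node a n l r, node a' n' l' r' => node (a ⊔ a') (n ⊔ n') (join l l') (join r r')
  | _, _ => inf

theorem join_left [SemilatticeSup α] [SemilatticeSup β] (s t : TreeDom α β) :
    le s (join s t) := by
  induction s generalizing t with
  | inf => cases t <;> trivial
  | emp => cases t <;> trivial
  | node a n l r hl hr =>
    cases t with
    | inf => trivial
    | emp => trivial
    | node b m l' r' => exact ⟨le_sup_left, le_sup_left, hl l', hr r'⟩

theorem join_right [SemilatticeSup α] [SemilatticeSup β] (s t : TreeDom α β) :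
    le t (join s t) := by
  induction s generalizing t with
  | inf => cases t <;> trivial
  | emp => cases t <;> trivial
  | node a n l r hl hr =>
    cases t with
    | inf => trivial
    | emp => trivial
    | node b m l' r' => exact ⟨le_sup_right, le_sup_right, hl l', hr r'⟩

theorem join_le [SemilatticeSup α] [SemilatticeSup β] (s t u : TreeDom α β) (h1 : le s u)
    (h2 : le t u) : le (join s t) u := by
  induction u generalizing s t with
  | inf => cases s <;> cases t <;> trivial
  | emp => cases s <;> cases t <;> simp_all [le, join]
  | node a n l r hl hr =>
    cases s <;> cases t <;> simp only [le] at h1 h2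
    exact ⟨sup_le h1.1 h2.1, sup_le h1.2.1 h2.2.1, hl _ _ h1.2.2.1 h2.2.2.1,
      hr _ _ h1.2.2.2 h2.2.2.2⟩

instance instSemilatticeSup [SemilatticeSup α] [SemilatticeSup β] :
    SemilatticeSup (TreeDom α β) where
  sup := join
  le_sup_left := join_left
  le_sup_right := join_right
  sup_le := join_le

/-- The semantic tree recursor: a two-level pattern match, with the subtrees two levels down
supplied together with the recursive results on them. -/
def rec₂ {C : Type} [Top C] (f₀ : C) (f₁ : α × β → C)
    (f₂ f₃ : α × β × α × β × (TreeDom α β × C) × (TreeDom α β × C) → C)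
    (f₄ : α × β × α × β × (TreeDom α β × C) × (TreeDom α β × C) ×
      α × β × (TreeDom α β × C) × (TreeDom α β × C) → C) : TreeDom α β → C
  | emp => f₀
  | node a n emp emp => f₁ (a, n)
  | node a n (node b m s t) emp =>
      f₂ (a, n, b, m, (s, rec₂ f₀ f₁ f₂ f₃ f₄ s), (t, rec₂ f₀ f₁ f₂ f₃ f₄ t))
  | node a n emp (node c k u v) =>
      f₃ (a, n, c, k, (u, rec₂ f₀ f₁ f₂ f₃ f₄ u), (v, rec₂ f₀ f₁ f₂ f₃ f₄ v))
  | node a n (node b m s t) (node c k u v) =>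
      f₄ (a, n, b, m, (s, rec₂ f₀ f₁ f₂ f₃ f₄ s), (t, rec₂ f₀ f₁ f₂ f₃ f₄ t),
        c, k, (u, rec₂ f₀ f₁ f₂ f₃ f₄ u), (v, rec₂ f₀ f₁ f₂ f₃ f₄ v))
  | inf => ⊤
  | node _ _ inf _ => ⊤
  | node _ _ _ inf => ⊤

theorem rec₂_mono [PartialOrder α] [PartialOrder β] {C : Type} [PartialOrder C] [OrderTop C]
    {f₀ g₀ : C} {f₁ g₁ : α × β →o C}
    {f₂ g₂ f₃ g₃ : α × β × α × β × (TreeDom α β × C) × (TreeDom α β × C) →o C}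
    {f₄ g₄ : α × β × α × β × (TreeDom α β × C) × (TreeDom α β × C) ×
      α × β × (TreeDom α β × C) × (TreeDom α β × C) →o C}
    (h₀ : f₀ ≤ g₀) (h₁ : f₁ ≤ g₁) (h₂ : f₂ ≤ g₂) (h₃ : f₃ ≤ g₃) (h₄ : f₄ ≤ g₄)
    (s t : TreeDom α β) (h : s ≤ t) :
    rec₂ f₀ f₁ f₂ f₃ f₄ s ≤ rec₂ g₀ g₁ g₂ g₃ g₄ t := by
  induction t using rec₂.induct (α := α) (β := β) generalizing s with
  | case1 => cases s <;> first | exact h₀ | exact h.elim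
  | case2 a n =>
    rcases s with _ | _ | ⟨a', n', _ | _ | _, _ | _ | _⟩ <;>
      first
      | exact h.elim
      | exact h.2.2.1.elim
      | exact h.2.2.2.elim
      | exact (f₁.monotone ⟨h.1, h.2.1⟩).trans (h₁ _)
  | case3 a n b m s₁ t₁ ih1 ih2 =>
    rcases s with _ | _ | ⟨a', n', _ | _ | ⟨b', m', s', t'⟩, _ | _ | _⟩ <;>
      first
      | exact h.elim
      | exact h.2.2.1.elim
      | exact h.2.2.2.elim
      | skip
    obtain ⟨ha, hn, ⟨hb, hm, hs, ht⟩, -⟩ := h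
    exact (f₂.monotone ⟨ha, hn, hb, hm, ⟨hs, ih1 _ hs⟩, ⟨ht, ih2 _ ht⟩⟩).trans (h₂ _)
  | case4 a n b m s₁ t₁ ih1 ih2 =>
    rcases s with _ | _ | ⟨a', n', _ | _ | _, _ | _ | ⟨b', m', s', t'⟩⟩ <;>
      first
      | exact h.elim
      | exact h.2.2.1.elim
      | exact h.2.2.2.elim
      | skip
    obtain ⟨ha, hn, -, ⟨hb, hm, hs, ht⟩⟩ := h
    exact (f₃.monotone ⟨ha, hn, hb, hm, ⟨hs, ih1 _ hs⟩, ⟨ht, ih2 _ ht⟩⟩).trans (h₃ _)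
  | case5 a n b m s₁ t₁ c k u v ih1 ih2 ih3 ih4 =>
    rcases s with _ | _ | ⟨a', n', _ | _ | ⟨b', m', s', t'⟩, _ | _ | ⟨c', k', u', v'⟩⟩ <;>
      first
      | exact h.elim
      | exact h.2.2.1.elim
      | exact h.2.2.2.elim
      | skip
    obtain ⟨ha, hn, ⟨hb, hm, hs, ht⟩, ⟨hc, hk, hu, hv⟩⟩ := h
    exact (f₄.monotone ⟨ha, hn, hb, hm, ⟨hs, ih1 _ hs⟩, ⟨ht, ih2 _ ht⟩, hc, hk, ⟨hu, ih3 _ hu⟩,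
      ⟨hv, ih4 _ hv⟩⟩).trans (h₄ _)
  | case6 => exact le_top
  | case7 => exact le_top
  | case8 a n t ht =>
    rcases t with _ | _ | _ <;> exact le_top

end TreeDom

end SplayCost

namespace SplayCost

/-! # The intermediate language `λᴬ` -/

/-- Simple types: the types of `λᴬ` with the annotations `k`, `ℓ` of `!ᵏ_ℓ` erased. `key` is the
type `A` of the keys, `lolli` is `⊸`, `with` is the lazy product `&`, `ex` is `∃ α`. -/
inductive STy where
  | unit
  | nat
  | key
  | tensor (a b : STy)
  | lolli (a b : STy)
  | wth (a b : STy)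
  | bang (a : STy)
  | ex (a : STy)
  | tree (a : STy)

/-- Entries of a context: a credit variable, or a term variable. -/
inductive Ent where
  | cred
  | tm (a : STy)

/-- Typed de Bruijn indices. -/
inductive Var {E : Type} : List E → E → Type where
  | z {γ : List E} {e : E} : Var (e :: γ) e
  | s {γ : List E} {e e' : E} : Var γ e → Var (e' :: γ) e

def Var.idx {E : Type} {γ : List E} {e : E} : Var γ e → ℕ
  | .z => 0
  | .s x => x.idx + 1

def Var.map {E F : Type} (f : E → F) {γ : List E} {e : E} : Var γ e → Var (γ.map f) (f e)
  | .z => .z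
  | .s x => .s (x.map f)

/-- Credit terms: a constant plus a finite sum of credit variables. -/
structure Cr (γ : List Ent) where
  const : ℕ
  vars : List (Var γ .cred)

/-- Raw terms of `λᴬ`, over keys from `K`; binders bind de Bruijn index `0` (and `1`).
* `save k c M` is `saveᵏ_c M`;
* `transfer k' k c M N` is `transfer_{k'} !ᵏ_c x = M to N`, binding `x`;
* `letPair k' M N` is the elimination of `k'` copies of `M : A ⊗ B`, binding the first component
  as index `1` and the second as index `0`;
* `ifLe M N P Q` compares the keys `M ≤ N` and continues as `P` or `Q`;
* `nrec M N₁ N₂` is the recursor on numbers;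
* `node M N L R` is a node with label `M` and cached size `N`;
* `trec M N₀ N₁ N₂ N₃ N₄` is the two-level recursor on trees, with branches for the empty tree, a
  node without children, with a left child only, with a right child only, and with two children;
* `unpack M N` binds the credit variable as index `1` and the term variable as index `0`. -/
inductive Tm (K : Type) : List Ent → STy → Type where
  | var {γ : List Ent} {a : STy} : Var γ (.tm a) → Tm K γ a
  | tick {γ : List Ent} {a : STy} : Tm K γ a → Tm K γ a
  | create {γ : List Ent} {a : STy} : Cr γ → Tm K γ a → Tm K γ a
  | spend {γ : List Ent} {a : STy} : Cr γ → Tm K γ a → Tm K γ a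
  | save {γ : List Ent} {a : STy} : ℕ∞ → Cr γ → Tm K γ a → Tm K γ (.bang a)
  | transfer {γ : List Ent} {a c : STy} :
      ℕ∞ → ℕ∞ → Cr γ → Tm K γ (.bang a) → Tm K (.tm a :: γ) c → Tm K γ c
  | unit {γ : List Ent} : Tm K γ .unit
  | pair {γ : List Ent} {a b : STy} : Tm K γ a → Tm K γ b → Tm K γ (.tensor a b)
  | letPair {γ : List Ent} {a b c : STy} :
      ℕ∞ → Tm K γ (.tensor a b) → Tm K (.tm b :: .tm a :: γ) c → Tm K γ c
  | lam {γ : List Ent} {a b : STy} : Tm K (.tm a :: γ) b → Tm K γ (.lolli a b)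
  | app {γ : List Ent} {a b : STy} : Tm K γ (.lolli a b) → Tm K γ a → Tm K γ b
  | withPair {γ : List Ent} {a b : STy} : Tm K γ a → Tm K γ b → Tm K γ (.wth a b)
  | fst {γ : List Ent} {a b : STy} : Tm K γ (.wth a b) → Tm K γ a
  | snd {γ : List Ent} {a b : STy} : Tm K γ (.wth a b) → Tm K γ b
  | zero {γ : List Ent} : Tm K γ .nat
  | succ {γ : List Ent} : Tm K γ .nat → Tm K γ .nat
  | nrec {γ : List Ent} {c : STy} : Tm K γ .nat → Tm K γ (.lolli .unit c) →
      Tm K γ (.bang (.lolli (.tensor .nat (.lolli .unit c)) c)) → Tm K γ c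
  | key {γ : List Ent} : K → Tm K γ .key
  | ifLe {γ : List Ent} {c : STy} :
      Tm K γ .key → Tm K γ .key → Tm K γ c → Tm K γ c → Tm K γ c
  | emp {γ : List Ent} {a : STy} : Tm K γ (.tree a)
  | node {γ : List Ent} {a : STy} :
      Tm K γ a → Tm K γ .nat → Tm K γ (.tree a) → Tm K γ (.tree a) → Tm K γ (.tree a)
  | trec {γ : List Ent} {a c : STy} : Tm K γ (.tree a) →
      Tm K γ (.bang (.lolli .unit c)) →
      Tm K γ (.bang (.lolli (.tensor a .nat) c)) →
      Tm K γ (.bang (.lolli (.tensor a (.tensor .nat (.tensor a (.tensor .nat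
        (.tensor (.wth (.tree a) c) (.wth (.tree a) c)))))) c)) →
      Tm K γ (.bang (.lolli (.tensor a (.tensor .nat (.tensor a (.tensor .nat
        (.tensor (.wth (.tree a) c) (.wth (.tree a) c)))))) c)) →
      Tm K γ (.bang (.lolli (.tensor a (.tensor .nat (.tensor a (.tensor .nat
        (.tensor (.wth (.tree a) c) (.tensor (.wth (.tree a) c) (.tensor a (.tensor .nat
        (.tensor (.wth (.tree a) c) (.wth (.tree a) c)))))))))) c)) →
      Tm K γ c
  | pack {γ : List Ent} {a : STy} : Cr γ → Tm K γ a → Tm K γ (.ex a)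
  | unpack {γ : List Ent} {a c : STy} :
      Tm K γ (.ex a) → Tm K (.tm a :: .cred :: γ) c → Tm K γ c

/-- Closed values. -/
inductive Tm.IsVal {K : Type} : {a : STy} → Tm K [] a → Prop where
  | unit : IsVal .unit
  | zero : IsVal .zero
  | succ {M : Tm K [] .nat} : IsVal M → IsVal (.succ M)
  | key (x : K) : IsVal (.key x)
  | lam {a b : STy} (M : Tm K [.tm a] b) : IsVal (.lam M)
  | withPair {a b : STy} (M : Tm K [] a) (N : Tm K [] b) : IsVal (.withPair M N)
  | pair {a b : STy} {M : Tm K [] a} {N : Tm K [] b} : IsVal M → IsVal N → IsVal (.pair M N)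
  | save {a : STy} (k : ℕ∞) (c : Cr []) {M : Tm K [] a} : IsVal M → IsVal (.save k c M)
  | pack {a : STy} (c : Cr []) {M : Tm K [] a} : IsVal M → IsVal (.pack c M)
  | emp {a : STy} : IsVal (.emp (a := a))
  | node {a : STy} {M : Tm K [] a} {N : Tm K [] .nat} {L R : Tm K [] (.tree a)} :
      IsVal M → IsVal N → IsVal L → IsVal R → IsVal (.node M N L R)

/-! ## Typing -/

/-- Atoms of the credit terms in types: one credit, a credit variable bound by an enclosing `∃`
(de Bruijn index), or a credit variable of the context (de Bruijn level). -/
inductive CAtom where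
  | one
  | bnd (i : ℕ)
  | free (l : ℕ)
  deriving DecidableEq

/-- Credit terms in types: finite formal sums of atoms. -/
abbrev TCr := Multiset CAtom

/-- Types of `λᴬ`; `bang k c A` is `!ᵏ_c A`. -/
inductive Ty where
  | unit
  | nat
  | key
  | tensor (A B : Ty)
  | lolli (A B : Ty)
  | wth (A B : Ty)
  | bang (k : ℕ∞) (c : TCr) (A : Ty)
  | ex (A : Ty)
  | tree (A : Ty)

def Ty.shape : Ty → STy
  | unit => .unit
  | nat => .nat
  | key => .key
  | tensor A B => .tensor A.shape B.shape
  | lolli A B => .lolli A.shape B.shape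
  | wth A B => .wth A.shape B.shape
  | bang _ _ A => .bang A.shape
  | ex A => .ex A.shape
  | tree A => .tree A.shape

/-- Substitution of the credit term `c` for the bound credit variable `d`. -/
def Ty.inst (c : TCr) : ℕ → Ty → Ty
  | _, unit => .unit
  | _, nat => .nat
  | _, key => .key
  | d, tensor A B => .tensor (A.inst c d) (B.inst c d)
  | d, lolli A B => .lolli (A.inst c d) (B.inst c d)
  | d, wth A B => .wth (A.inst c d) (B.inst c d)
  | d, bang k e A => .bang k (e.bind fun x => if x = .bnd d then c else {x}) (A.inst c d)
  | d, ex A => .ex (A.inst c (d + 1))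
  | d, tree A => .tree (A.inst c d)

/-- Typing contexts; `none` stands for a credit variable. -/
abbrev Ctx := List (Option Ty)

/-- Well-formedness of a type in a context and under `b` existential quantifiers: its credit
variables are in scope and its multiplicities are positive. -/
def Ty.WF (Γ : Ctx) : ℕ → Ty → Prop
  | _, unit => True
  | _, nat => True
  | _, key => True
  | b, tensor A B => A.WF Γ b ∧ B.WF Γ b
  | b, lolli A B => A.WF Γ b ∧ B.WF Γ b
  | b, wth A B => A.WF Γ b ∧ B.WF Γ b
  | b, bang k c A => k ≠ 0 ∧
      (∀ i, .bnd i ∈ c → i < b) ∧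
      (∀ l, .free l ∈ c → l < Γ.length ∧ Γ[Γ.length - 1 - l]? = some none) ∧ A.WF Γ b
  | b, ex A => A.WF Γ (b + 1)
  | b, tree A => A.WF Γ b

/-- A credit term as it appears in types, over a context of length `n`. -/
def Cr.toTCr {γ : List Ent} (n : ℕ) (c : Cr γ) : TCr :=
  Multiset.replicate c.const CAtom.one +
    Multiset.ofList (c.vars.map fun x => CAtom.free (n - 1 - x.idx))

/-- Resource terms: a constant number of credits in the bank, and for each variable of the context
(by de Bruijn index) a coefficient, which is the number of permitted uses for a term variable and
the coefficient in the bank for a credit variable. Sums, multiples and `≤` are coefficientwise. -/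
abbrev Res := ℕ∞ × (ℕ → ℕ∞)

/-- The resource term over an extended context in which the new variable has coefficient `k`. -/
def Res.cons (k : ℕ∞) (f : Res) : Res :=
  (f.1, fun i => i.casesOn k f.2)

def Cr.toRes {γ : List Ent} (c : Cr γ) : Res :=
  (c.const, fun i => ((c.vars.countP fun x => x.idx = i : ℕ) : ℕ∞))

/-- The typing judgment `Γ ⊢_f M : A` (credit and term variables are kept in one context). -/
inductive HasTy {K : Type} : {γ : List Ent} → {a : STy} → Ctx → Res → Tm K γ a → Ty → Prop where
  | weaken {γ : List Ent} {a : STy} {Γ : Ctx} {f g : Res} {M : Tm K γ a} {A : Ty} :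
      HasTy Γ f M A → f ≤ g → HasTy Γ g M A
  | var {γ : List Ent} {a : STy} {Γ : Ctx} {x : Var γ (.tm a)} {A : Ty} :
      Γ[x.idx]? = some (some A) → HasTy Γ (0, Pi.single x.idx 1) (.var x) A
  | tick {γ : List Ent} {a : STy} {Γ : Ctx} {f : Res} {M : Tm K γ a} {A : Ty} :
      HasTy Γ f M A → HasTy Γ f (.tick M) A
  | create {γ : List Ent} {a : STy} {Γ : Ctx} {f : Res} {c : Cr γ} {M : Tm K γ a} {A : Ty} :
      HasTy Γ (f + c.toRes) M A → HasTy Γ f (.create c M) A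
  | spend {γ : List Ent} {a : STy} {Γ : Ctx} {f : Res} {c : Cr γ} {M : Tm K γ a} {A : Ty} :
      HasTy Γ f M A → HasTy Γ (f + c.toRes) (.spend c M) A
  | save {γ : List Ent} {a : STy} {Γ : Ctx} {f : Res} {k : ℕ∞} {c : Cr γ} {M : Tm K γ a}
      {A : Ty} : k ≠ 0 → HasTy Γ f M A →
      HasTy Γ (k • f + c.toRes) (.save k c M) (.bang k (c.toTCr Γ.length) A)
  | transfer {γ : List Ent} {a c : STy} {Γ : Ctx} {f g : Res} {k' k : ℕ∞} {e : Cr γ}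
      {M : Tm K γ (.bang a)} {N : Tm K (.tm a :: γ) c} {A C : Ty} : k' ≠ 0 →
      HasTy Γ f M (.bang k (e.toTCr Γ.length) A) →
      HasTy (some A :: Γ) (Res.cons (k' * k) (g + k' • e.toRes)) N C →
      HasTy Γ (k' • f + g) (.transfer k' k e M N) C
  | unit {γ : List Ent} {Γ : Ctx} : HasTy Γ 0 (.unit : Tm K γ _) .unit
  | pair {γ : List Ent} {a b : STy} {Γ : Ctx} {f g : Res} {M : Tm K γ a} {N : Tm K γ b}
      {A B : Ty} : HasTy Γ f M A → HasTy Γ g N B → HasTy Γ (f + g) (.pair M N) (.tensor A B)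
  | letPair {γ : List Ent} {a b c : STy} {Γ : Ctx} {f g : Res} {k' : ℕ∞}
      {M : Tm K γ (.tensor a b)} {N : Tm K (.tm b :: .tm a :: γ) c} {A B C : Ty} : k' ≠ 0 →
      HasTy Γ f M (.tensor A B) →
      HasTy (some B :: some A :: Γ) (Res.cons k' (Res.cons k' g)) N C →
      HasTy Γ (k' • f + g) (.letPair k' M N) C
  | lam {γ : List Ent} {a b : STy} {Γ : Ctx} {f : Res} {M : Tm K (.tm a :: γ) b} {A B : Ty} :
      A.shape = a → A.WF Γ 0 → HasTy (some A :: Γ) (Res.cons 1 f) M B →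
      HasTy Γ f (.lam M) (.lolli A B)
  | app {γ : List Ent} {a b : STy} {Γ : Ctx} {f g : Res} {M : Tm K γ (.lolli a b)}
      {N : Tm K γ a} {A B : Ty} : HasTy Γ f M (.lolli A B) → HasTy Γ g N A →
      HasTy Γ (f + g) (.app M N) B
  | withPair {γ : List Ent} {a b : STy} {Γ : Ctx} {f : Res} {M : Tm K γ a} {N : Tm K γ b}
      {A B : Ty} : HasTy Γ f M A → HasTy Γ f N B → HasTy Γ f (.withPair M N) (.wth A B)
  | fst {γ : List Ent} {a b : STy} {Γ : Ctx} {f : Res} {M : Tm K γ (.wth a b)} {A B : Ty} :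
      HasTy Γ f M (.wth A B) → HasTy Γ f (.fst M) A
  | snd {γ : List Ent} {a b : STy} {Γ : Ctx} {f : Res} {M : Tm K γ (.wth a b)} {A B : Ty} :
      HasTy Γ f M (.wth A B) → HasTy Γ f (.snd M) B
  | zero {γ : List Ent} {Γ : Ctx} : HasTy Γ 0 (.zero : Tm K γ _) .nat
  | succ {γ : List Ent} {Γ : Ctx} {f : Res} {M : Tm K γ .nat} :
      HasTy Γ f M .nat → HasTy Γ f (.succ M) .nat
  | nrec {γ : List Ent} {c : STy} {Γ : Ctx} {f g h : Res} {M : Tm K γ .nat}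
      {N₁ : Tm K γ (.lolli .unit c)}
      {N₂ : Tm K γ (.bang (.lolli (.tensor .nat (.lolli .unit c)) c))} {C : Ty} :
      HasTy Γ f M .nat → HasTy Γ g N₁ (.lolli .unit C) →
      HasTy Γ h N₂ (.bang ⊤ 0 (.lolli (.tensor .nat (.lolli .unit C)) C)) →
      HasTy Γ (f + g + h) (.nrec M N₁ N₂) C
  | key {γ : List Ent} {Γ : Ctx} (x : K) : HasTy Γ 0 (.key x : Tm K γ _) .key
  | ifLe {γ : List Ent} {c : STy} {Γ : Ctx} {f g h : Res} {M N : Tm K γ .key} {P Q : Tm K γ c}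
      {C : Ty} : HasTy Γ f M .key → HasTy Γ g N .key → HasTy Γ h P C → HasTy Γ h Q C →
      HasTy Γ (f + g + h) (.ifLe M N P Q) C
  | emp {γ : List Ent} {a : STy} {Γ : Ctx} {A : Ty} : A.shape = a → A.WF Γ 0 →
      HasTy Γ 0 (.emp : Tm K γ (.tree a)) (.tree A)
  | node {γ : List Ent} {a : STy} {Γ : Ctx} {f g h i : Res} {M : Tm K γ a} {N : Tm K γ .nat}
      {L R : Tm K γ (.tree a)} {A : Ty} : HasTy Γ f M A → HasTy Γ g N .nat →
      HasTy Γ h L (.tree A) → HasTy Γ i R (.tree A) →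
      HasTy Γ (f + g + h + i) (.node M N L R) (.tree A)
  | trec {γ : List Ent} {a c : STy} {Γ : Ctx} {f g₀ g₁ g₂ g₃ g₄ : Res} {M : Tm K γ (.tree a)}
      {N₀ : Tm K γ (.bang (.lolli .unit c))}
      {N₁ : Tm K γ (.bang (.lolli (.tensor a .nat) c))}
      {N₂ N₃ : Tm K γ (.bang (.lolli (.tensor a (.tensor .nat (.tensor a (.tensor .nat
        (.tensor (.wth (.tree a) c) (.wth (.tree a) c)))))) c))}
      {N₄ : Tm K γ (.bang (.lolli (.tensor a (.tensor .nat (.tensor a (.tensor .nat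
        (.tensor (.wth (.tree a) c) (.tensor (.wth (.tree a) c) (.tensor a (.tensor .nat
        (.tensor (.wth (.tree a) c) (.wth (.tree a) c)))))))))) c))} {A C : Ty} :
      HasTy Γ f M (.tree A) →
      HasTy Γ g₀ N₀ (.bang ⊤ 0 (.lolli .unit C)) →
      HasTy Γ g₁ N₁ (.bang ⊤ 0 (.lolli (.tensor A .nat) C)) →
      HasTy Γ g₂ N₂ (.bang ⊤ 0 (.lolli (.tensor A (.tensor .nat (.tensor A (.tensor .nat
        (.tensor (.wth (.tree A) C) (.wth (.tree A) C)))))) C)) →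
      HasTy Γ g₃ N₃ (.bang ⊤ 0 (.lolli (.tensor A (.tensor .nat (.tensor A (.tensor .nat
        (.tensor (.wth (.tree A) C) (.wth (.tree A) C)))))) C)) →
      HasTy Γ g₄ N₄ (.bang ⊤ 0 (.lolli (.tensor A (.tensor .nat (.tensor A (.tensor .nat
        (.tensor (.wth (.tree A) C) (.tensor (.wth (.tree A) C) (.tensor A (.tensor .nat
        (.tensor (.wth (.tree A) C) (.wth (.tree A) C)))))))))) C)) →
      HasTy Γ (f + g₀ + g₁ + g₂ + g₃ + g₄) (.trec M N₀ N₁ N₂ N₃ N₄) C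
  | pack {γ : List Ent} {a : STy} {Γ : Ctx} {f : Res} {c : Cr γ} {M : Tm K γ a} {A : Ty} :
      HasTy Γ f M (A.inst (c.toTCr Γ.length) 0) → HasTy Γ f (.pack c M) (.ex A)
  | unpack {γ : List Ent} {a c : STy} {Γ : Ctx} {f g : Res} {M : Tm K γ (.ex a)}
      {N : Tm K (.tm a :: .cred :: γ) c} {A C : Ty} : C.WF Γ 0 →
      HasTy Γ f M (.ex A) →
      HasTy (some (A.inst {.free Γ.length} 0) :: none :: Γ) (Res.cons 1 (Res.cons 0 g)) N C →
      HasTy Γ (f + g) (.unpack M N) C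

/-! # The recurrence language `λ^ℂ` -/

/-- Types of `λ^ℂ`; `cred` is the type `$` of credit amounts, `cost` is `ℂ`. -/
inductive CTy where
  | unit
  | nat
  | cred
  | cost
  | key
  | prod (a b : CTy)
  | arr (a b : CTy)
  | tree (a : CTy)

/-- Terms of `λ^ℂ`. `smul k` multiplies a cost by a multiplicity; `toC` is the inclusion of `$`
into `ℂ` and `negC` its negative. -/
inductive CTm (K : Type) : List CTy → CTy → Type where
  | var {Γ : List CTy} {a : CTy} : Var Γ a → CTm K Γ a
  | unit {Γ : List CTy} : CTm K Γ .unit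
  | pair {Γ : List CTy} {a b : CTy} : CTm K Γ a → CTm K Γ b → CTm K Γ (.prod a b)
  | fst {Γ : List CTy} {a b : CTy} : CTm K Γ (.prod a b) → CTm K Γ a
  | snd {Γ : List CTy} {a b : CTy} : CTm K Γ (.prod a b) → CTm K Γ b
  | lam {Γ : List CTy} {a b : CTy} : CTm K (a :: Γ) b → CTm K Γ (.arr a b)
  | app {Γ : List CTy} {a b : CTy} : CTm K Γ (.arr a b) → CTm K Γ a → CTm K Γ b
  | cst {Γ : List CTy} : ℤ → CTm K Γ .cost
  | plus {Γ : List CTy} : CTm K Γ .cost → CTm K Γ .cost → CTm K Γ .cost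
  | smul {Γ : List CTy} : ℕ∞ → CTm K Γ .cost → CTm K Γ .cost
  | ccst {Γ : List CTy} : ℕ → CTm K Γ .cred
  | cplus {Γ : List CTy} : CTm K Γ .cred → CTm K Γ .cred → CTm K Γ .cred
  | toC {Γ : List CTy} : CTm K Γ .cred → CTm K Γ .cost
  | negC {Γ : List CTy} : CTm K Γ .cred → CTm K Γ .cost
  | zero {Γ : List CTy} : CTm K Γ .nat
  | succ {Γ : List CTy} : CTm K Γ .nat → CTm K Γ .nat
  | nrec {Γ : List CTy} {c : CTy} : CTm K Γ .nat → CTm K Γ (.arr .unit c) →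
      CTm K Γ (.arr (.prod .nat c) c) → CTm K Γ c
  | key {Γ : List CTy} : K → CTm K Γ .key
  | ifLe {Γ : List CTy} {c : CTy} :
      CTm K Γ .key → CTm K Γ .key → CTm K Γ c → CTm K Γ c → CTm K Γ c
  | emp {Γ : List CTy} {a : CTy} : CTm K Γ (.tree a)
  | node {Γ : List CTy} {a : CTy} :
      CTm K Γ a → CTm K Γ .nat → CTm K Γ (.tree a) → CTm K Γ (.tree a) → CTm K Γ (.tree a)
  | trec {Γ : List CTy} {a c : CTy} : CTm K Γ (.tree a) →
      CTm K Γ (.arr .unit c) →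
      CTm K Γ (.arr (.prod a .nat) c) →
      CTm K Γ (.arr (.prod a (.prod .nat (.prod a (.prod .nat
        (.prod (.prod (.tree a) c) (.prod (.tree a) c)))))) c) →
      CTm K Γ (.arr (.prod a (.prod .nat (.prod a (.prod .nat
        (.prod (.prod (.tree a) c) (.prod (.tree a) c)))))) c) →
      CTm K Γ (.arr (.prod a (.prod .nat (.prod a (.prod .nat
        (.prod (.prod (.tree a) c) (.prod (.prod (.tree a) c) (.prod a (.prod .nat
        (.prod (.prod (.tree a) c) (.prod (.tree a) c)))))))))) c) →
      CTm K Γ c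

/-! ## Recurrence extraction -/

/-- The potential type `⟨⟨A⟩⟩`; it does not depend on the annotations of `!ᵏ_ℓ`. -/
def STy.pot : STy → CTy
  | unit => .unit
  | nat => .nat
  | key => .key
  | tensor a b => .prod a.pot b.pot
  | lolli a b => .arr a.pot (.prod .cost b.pot)
  | wth a b => .prod (.prod .cost a.pot) (.prod .cost b.pot)
  | bang a => a.pot
  | ex a => .prod .cred a.pot
  | tree a => .tree a.pot

def Ent.pot : Ent → CTy
  | cred => .cred
  | tm a => a.pot

/-- `E +_c E'`, which adds the cost `E` to the complexity `E'`. -/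
def CTm.charge {K : Type} {Γ : List CTy} {a : CTy} (E : CTm K Γ .cost)
    (E' : CTm K Γ (.prod .cost a)) : CTm K Γ (.prod .cost a) :=
  .pair (.plus E (.fst E')) (.snd E')

def Cr.toCTm {K : Type} {γ : List Ent} (c : Cr γ) : CTm K (γ.map Ent.pot) .cred :=
  c.vars.foldr (fun x E => .cplus (.var (x.map Ent.pot)) E) (.ccst c.const)

/-- `λ g. λ p. g (π₁ p, λ z. π₂ p)`: passes the recursive result of `nrec` as a thunk. -/
def CTm.stepNrec {K : Type} {Γ : List CTy} {c : CTy} :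
    CTm K Γ (.arr (.arr (.prod .nat (.arr .unit c)) c) (.arr (.prod .nat c) c)) :=
  .lam (.lam (.app (.var (.s .z))
    (.pair (.fst (.var .z)) (.lam (.snd (.var (.s .z)))))))

/-- A subtree with its recursive result, as the potential of a lazy pair: subtrees are values, so
the cost of the subtree is `0`. -/
def CTm.lazyPair {K : Type} {Γ : List CTy} {t c : CTy} (E : CTm K Γ (.prod t c)) :
    CTm K Γ (.prod (.prod .cost t) c) :=
  .pair (.pair (.cst 0) (.fst E)) (.snd E)

/-- Passes the subtrees and recursive results of a node with one child as lazy pairs. -/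
def CTm.stepOne {K : Type} {Γ : List CTy} {a t c : CTy} :
    CTm K Γ (.arr
      (.arr (.prod a (.prod .nat (.prod a (.prod .nat
        (.prod (.prod (.prod .cost t) c) (.prod (.prod .cost t) c)))))) c)
      (.arr (.prod a (.prod .nat (.prod a (.prod .nat (.prod (.prod t c) (.prod t c)))))) c)) :=
  .lam (.lam (.app (.var (.s .z))
    (.pair (.fst (.var .z))
    (.pair (.fst (.snd (.var .z)))
    (.pair (.fst (.snd (.snd (.var .z))))
    (.pair (.fst (.snd (.snd (.snd (.var .z)))))
    (.pair (.lazyPair (.fst (.snd (.snd (.snd (.snd (.var .z)))))))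
      (.lazyPair (.snd (.snd (.snd (.snd (.snd (.var .z))))))))))))))

/-- Passes the subtrees and recursive results of a node with two children as lazy pairs. -/
def CTm.stepTwo {K : Type} {Γ : List CTy} {a t c : CTy} :
    CTm K Γ (.arr
      (.arr (.prod a (.prod .nat (.prod a (.prod .nat
        (.prod (.prod (.prod .cost t) c) (.prod (.prod (.prod .cost t) c) (.prod a (.prod .nat
        (.prod (.prod (.prod .cost t) c) (.prod (.prod .cost t) c)))))))))) c)
      (.arr (.prod a (.prod .nat (.prod a (.prod .nat (.prod (.prod t c) (.prod (.prod t c)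
        (.prod a (.prod .nat (.prod (.prod t c) (.prod t c)))))))))) c)) :=
  .lam (.lam (.app (.var (.s .z))
    (.pair (.fst (.var .z))
    (.pair (.fst (.snd (.var .z)))
    (.pair (.fst (.snd (.snd (.var .z))))
    (.pair (.fst (.snd (.snd (.snd (.var .z)))))
    (.pair (.lazyPair (.fst (.snd (.snd (.snd (.snd (.var .z)))))))
    (.pair (.lazyPair (.fst (.snd (.snd (.snd (.snd (.snd (.var .z))))))))
    (.pair (.fst (.snd (.snd (.snd (.snd (.snd (.snd (.var .z))))))))
    (.pair (.fst (.snd (.snd (.snd (.snd (.snd (.snd (.snd (.var .z)))))))))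
    (.pair (.lazyPair (.fst (.snd (.snd (.snd (.snd (.snd (.snd (.snd (.snd (.var .z)))))))))))
      (.lazyPair (.snd (.snd (.snd (.snd (.snd (.snd (.snd (.snd (.snd (.var .z))))))))))))))))))))))

/-- Recurrence extraction `‖M‖ : ℂ × ⟨⟨A⟩⟩`. Substitution of potentials for variables is written as
a `β`-redex. -/
def Tm.extract {K : Type} : {γ : List Ent} → {a : STy} → Tm K γ a →
    CTm K (γ.map Ent.pot) (.prod .cost a.pot)
  | _, _, .var x => .pair (.cst 0) (.var (x.map Ent.pot))
  | _, _, .tick M => .charge (.cst 1) M.extract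
  | _, _, .create c M => .charge (.toC c.toCTm) M.extract
  | _, _, .spend c M => .charge (.negC c.toCTm) M.extract
  | _, _, .save k _ M => .pair (.smul k (.fst M.extract)) (.snd M.extract)
  | _, _, .transfer k' _ _ M N =>
      .charge (.smul k' (.fst M.extract)) (.app (.lam N.extract) (.snd M.extract))
  | _, _, .unit => .pair (.cst 0) .unit
  | _, _, .pair M N =>
      .pair (.plus (.fst M.extract) (.fst N.extract)) (.pair (.snd M.extract) (.snd N.extract))
  | _, _, .letPair k' M N =>
      .charge (.smul k' (.fst M.extract))
        (.app (.app (.lam (.lam N.extract)) (.fst (.snd M.extract))) (.snd (.snd M.extract)))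
  | _, _, .lam M => .pair (.cst 0) (.lam M.extract)
  | _, _, .app M N =>
      .charge (.plus (.fst M.extract) (.fst N.extract)) (.app (.snd M.extract) (.snd N.extract))
  | _, _, .withPair M N => .pair (.cst 0) (.pair M.extract N.extract)
  | _, _, .fst M => .charge (.fst M.extract) (.fst (.snd M.extract))
  | _, _, .snd M => .charge (.fst M.extract) (.snd (.snd M.extract))
  | _, _, .zero => .pair (.cst 0) .zero
  | _, _, .succ M => .pair (.fst M.extract) (.succ (.snd M.extract))
  | _, _, .nrec M N₁ N₂ =>
      .charge (.plus (.fst M.extract) (.plus (.fst N₁.extract) (.fst N₂.extract)))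
        (.nrec (.snd M.extract) (.snd N₁.extract) (.app .stepNrec (.snd N₂.extract)))
  | _, _, .key x => .pair (.cst 0) (.key x)
  | _, _, .ifLe M N P Q =>
      .charge (.plus (.fst M.extract) (.fst N.extract))
        (.ifLe (.snd M.extract) (.snd N.extract) P.extract Q.extract)
  | _, _, .emp => .pair (.cst 0) .emp
  | _, _, .node M N L R =>
      .pair (.plus (.fst M.extract) (.plus (.fst N.extract)
          (.plus (.fst L.extract) (.fst R.extract))))
        (.node (.snd M.extract) (.snd N.extract) (.snd L.extract) (.snd R.extract))
  | _, _, .trec M N₀ N₁ N₂ N₃ N₄ =>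
      .charge (.plus (.fst M.extract) (.plus (.fst N₀.extract) (.plus (.fst N₁.extract)
          (.plus (.fst N₂.extract) (.plus (.fst N₃.extract) (.fst N₄.extract))))))
        (.trec (.snd M.extract) (.snd N₀.extract) (.snd N₁.extract)
          (.app .stepOne (.snd N₂.extract)) (.app .stepOne (.snd N₃.extract))
          (.app .stepTwo (.snd N₄.extract)))
  | _, _, .pack c M => .pair (.fst M.extract) (.pair c.toCTm (.snd M.extract))
  | _, _, .unpack M N =>
      .charge (.fst M.extract)
        (.app (.app (.lam (.lam N.extract)) (.fst (.snd M.extract))) (.snd (.snd M.extract)))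

/-! ## Semantics of `λ^ℂ` in posets -/

/-- The interpretation of types. Numbers, credit amounts and keys are interpreted exactly, by flat
posets with `∞`; costs by `ℤ ∪ {∞}` with its usual order. -/
def CTy.dom (K : Type) [LinearOrder K] : CTy → Dom
  | unit => ⟨PUnit⟩
  | nat => ⟨Flat ℕ⟩
  | cred => ⟨Flat ℕ⟩
  | cost => ⟨WithTop ℤ⟩
  | key => ⟨Flat K⟩
  | prod a b => ⟨(a.dom K).carrier × (b.dom K).carrier⟩
  | arr a b => ⟨(a.dom K).carrier →o (b.dom K).carrier⟩
  | tree a => ⟨TreeDom (a.dom K).carrier (Flat ℕ)⟩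

abbrev CTy.den (K : Type) [LinearOrder K] (a : CTy) : Type := (a.dom K).carrier

def envDom (K : Type) [LinearOrder K] : List CTy → Dom
  | [] => ⟨PUnit⟩
  | a :: Γ => ⟨a.den K × (envDom K Γ).carrier⟩

/-- The interpretation of contexts. -/
abbrev Env (K : Type) [LinearOrder K] (Γ : List CTy) : Type := (envDom K Γ).carrier

namespace Sem

variable {G A B C : Type} [PartialOrder G] [PartialOrder A] [PartialOrder B]

def lam [PartialOrder C] (f : A × G →o C) : G →o (A →o C) where
  toFun γ := ⟨fun x => f (x, γ), fun _ _ h => f.monotone ⟨h, le_rfl⟩⟩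
  monotone' _ _ h _ := f.monotone ⟨le_rfl, h⟩

def app [PartialOrder C] (f : G →o (A →o C)) (x : G →o A) : G →o C where
  toFun γ := f γ (x γ)
  monotone' _ _ h := (f.monotone h _).trans ((f _).monotone (x.monotone h))

noncomputable def plus (f g : G →o WithTop ℤ) : G →o WithTop ℤ where
  toFun γ := f γ + g γ
  monotone' _ _ h := add_le_add (f.monotone h) (g.monotone h)

/-- Multiplication of a cost by a multiplicity `k`; it is the supremum of the multiples by the
finite `n ≤ k` if `k = ∞`. -/
noncomputable def smul (k : ℕ∞) : WithTop ℤ →o WithTop ℤ where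
  toFun x := if k = ⊤ then (if x ≤ 0 then 0 else ⊤) else k.toNat • x
  monotone' x y h := by
    dsimp only
    split_ifs with h1 h2 h3 h3
    · exact le_rfl
    · exact le_top
    · exact absurd (h.trans h3) h2
    · exact le_rfl
    · exact nsmul_le_nsmul_right h _

/-- The recursor on numbers. -/
def natRec [PartialOrder C] [OrderTop C] (f : G →o (PUnit →o C))
    (g : G →o (Flat ℕ × C →o C)) : G × Flat ℕ →o C where
  toFun p := Flat.lift (fun n : ℕ =>
    (Nat.rec (f p.1 PUnit.unit) (fun m r => g p.1 (.val m, r)) n : C)) p.2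
  monotone' := by
    rintro ⟨γ, s⟩ ⟨γ', t⟩ ⟨h1, h2⟩
    rcases h2 with rfl | rfl
    · exact le_top
    · rcases s with n | _
      · change (Nat.rec (f γ PUnit.unit) (fun m r => g γ (.val m, r)) n : C) ≤
          Nat.rec (f γ' PUnit.unit) (fun m r => g γ' (.val m, r)) n
        induction n with
        | zero => exact f.monotone h1 _
        | succ m ih => exact (g.monotone h1 _).trans ((g γ').monotone ⟨le_rfl, ih h1⟩)
      · exact le_top

/-- Comparison of keys; the maximum of both branches if a key is `∞`. -/
def ifLe {K : Type} [LinearOrder K] [SemilatticeSup C] (k l : G →o Flat K) (f g : G →o C) :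
    G →o C where
  toFun γ :=
    match k γ, l γ with
    | .val x, .val y => if x ≤ y then f γ else g γ
    | _, _ => f γ ⊔ g γ
  monotone' γ γ' h := by
    have key : ∀ {s s' t t' : Flat K}, s ≤ s' → t ≤ t' →
        (match s, t with
          | .val x, .val y => if x ≤ y then f γ else g γ
          | _, _ => f γ ⊔ g γ) ≤
        (match s', t' with
          | .val x, .val y => if x ≤ y then f γ' else g γ'
          | _, _ => f γ' ⊔ g γ') := by
      have hs : f γ ⊔ g γ ≤ f γ' ⊔ g γ' := sup_le_sup (f.monotone h) (g.monotone h)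
      have hs' : ∀ s t : Flat K, (match s, t with
          | .val x, .val y => if x ≤ y then f γ else g γ
          | _, _ => f γ ⊔ g γ) ≤ f γ' ⊔ g γ' := by
        intro s t
        rcases s with x | _ <;> rcases t with y | _ <;> try exact hs
        dsimp only
        split_ifs
        · exact le_sup_left.trans hs
        · exact le_sup_right.trans hs
      intro s s' t t' h1 h2
      rcases h1 with rfl | rfl
      · rcases t' with y | _
        · exact hs' s t
        · exact hs' s t
      · rcases h2 with rfl | rfl
        · rcases s with y | _
          · exact hs' (.val y) t
          · exact hs' .inf t
        · rcases s with x | _ <;> rcases t with y | _ <;> try exact hs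
          dsimp only
          split_ifs
          · exact f.monotone h
          · exact g.monotone h
    exact key (k.monotone h) (l.monotone h)

def node (a : G →o A) (n : G →o B) (l r : G →o TreeDom A B) : G →o TreeDom A B where
  toFun γ := .node (a γ) (n γ) (l γ) (r γ)
  monotone' _ _ h := ⟨a.monotone h, n.monotone h, l.monotone h, r.monotone h⟩

/-- The recursor on trees. -/
def treeRec [PartialOrder C] [OrderTop C] (t : G →o TreeDom A B) (f₀ : G →o (PUnit →o C))
    (f₁ : G →o (A × B →o C))
    (f₂ f₃ : G →o (A × B × A × B × (TreeDom A B × C) × (TreeDom A B × C) →o C))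
    (f₄ : G →o (A × B × A × B × (TreeDom A B × C) × (TreeDom A B × C) ×
      A × B × (TreeDom A B × C) × (TreeDom A B × C) →o C)) : G →o C where
  toFun γ := (t γ).rec₂ (f₀ γ PUnit.unit) (f₁ γ) (f₂ γ) (f₃ γ) (f₄ γ)
  monotone' _ _ h := TreeDom.rec₂_mono (f₀.monotone h _) (f₁.monotone h) (f₂.monotone h)
    (f₃.monotone h) (f₄.monotone h) _ _ (t.monotone h)

end Sem

def Var.den {K : Type} [LinearOrder K] : {Γ : List CTy} → {a : CTy} → Var Γ a →
    (Env K Γ →o a.den K)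
  | _, _, .z (γ := Γ) (e := a) => (OrderHom.fst : a.den K × Env K Γ →o a.den K)
  | _, _, .s (γ := Γ) (e := a) (e' := b) x =>
      ((x.den : Env K Γ →o a.den K).comp (OrderHom.snd : b.den K × Env K Γ →o Env K Γ))

/-- The interpretation `⟦E⟧` of terms of `λ^ℂ`, as monotone maps. -/
noncomputable def CTm.den {K : Type} [LinearOrder K] : {Γ : List CTy} → {a : CTy} → CTm K Γ a →
    (Env K Γ →o a.den K)
  | _, _, .var x => x.den
  | Γ, _, .unit => (OrderHom.const (Env K Γ) PUnit.unit : Env K Γ →o PUnit)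
  | Γ, _, .pair (a := a) (b := b) E F =>
      (OrderHom.prod (α := Env K Γ) (β := a.den K) (γ := b.den K) E.den F.den)
  | Γ, _, .fst (a := a) (b := b) E =>
      (OrderHom.fst : a.den K × b.den K →o a.den K).comp (α := Env K Γ) E.den
  | Γ, _, .snd (a := a) (b := b) E =>
      (OrderHom.snd : a.den K × b.den K →o b.den K).comp (α := Env K Γ) E.den
  | Γ, _, .lam (a := a) (b := b) E => Sem.lam (G := Env K Γ) (A := a.den K) (C := b.den K) E.den
  | Γ, _, .app (a := a) (b := b) E F =>
      Sem.app (G := Env K Γ) (A := a.den K) (C := b.den K) E.den F.den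
  | Γ, _, .cst n => OrderHom.const (Env K Γ) ((n : ℤ) : WithTop ℤ)
  | Γ, _, .plus E F => Sem.plus (G := Env K Γ) E.den F.den
  | Γ, _, .smul k E => (Sem.smul k).comp (α := Env K Γ) E.den
  | Γ, _, .ccst n => OrderHom.const (Env K Γ) (Flat.val n)
  | Γ, _, .cplus E F => (Flat.map₂ (fun m n : ℕ => m + n)).comp
      (OrderHom.prod (α := Env K Γ) (β := Flat ℕ) (γ := Flat ℕ) E.den F.den)
  | Γ, _, .toC E => (Flat.lift fun n : ℕ => (((n : ℕ) : ℤ) : WithTop ℤ)).comp (α := Env K Γ) E.den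
  | Γ, _, .negC E =>
      (Flat.lift fun n : ℕ => ((-((n : ℕ) : ℤ) : ℤ) : WithTop ℤ)).comp (α := Env K Γ) E.den
  | Γ, _, .zero => OrderHom.const (Env K Γ) (Flat.val (0 : ℕ))
  | Γ, _, .succ E => (Flat.map fun n : ℕ => n + 1).comp (α := Env K Γ) E.den
  | Γ, _, .nrec (c := c) E F G =>
      (Sem.natRec (G := Env K Γ) (C := c.den K) F.den G.den).comp
        (OrderHom.prod (α := Env K Γ) (β := Env K Γ) (γ := Flat ℕ) OrderHom.id E.den)
  | Γ, _, .key x => OrderHom.const (Env K Γ) (Flat.val x)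
  | Γ, _, .ifLe (c := c) E F G H =>
      Sem.ifLe (G := Env K Γ) (C := c.den K) (K := K) E.den F.den G.den H.den
  | Γ, _, .emp (a := a) => OrderHom.const (Env K Γ) (TreeDom.emp : TreeDom (a.den K) (Flat ℕ))
  | Γ, _, .node (a := a) E F G H =>
      Sem.node (G := Env K Γ) (A := a.den K) (B := Flat ℕ) E.den F.den G.den H.den
  | Γ, _, .trec (a := a) (c := c) E F₀ F₁ F₂ F₃ F₄ =>
      Sem.treeRec (G := Env K Γ) (A := a.den K) (B := Flat ℕ) (C := c.den K)
        E.den F₀.den F₁.den F₂.den F₃.den F₄.den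

/-- `⟦‖M‖_c⟧` for a closed term `M`. -/
noncomputable def Tm.costDen {K : Type} [LinearOrder K] {a : STy} (M : Tm K [] a) : WithTop ℤ :=
  (CTm.fst M.extract).den PUnit.unit

/-- `⟦‖M‖_p⟧` for a closed term `M`. -/
noncomputable def Tm.potDen {K : Type} [LinearOrder K] {a : STy} (M : Tm K [] a) : a.pot.den K :=
  (CTm.snd M.extract).den PUnit.unit


/-! # Splay trees in `λᴬ` -/

abbrev x0 {K : Type} {γ : List Ent} {a : STy} :
    Tm K (.tm a :: γ) a :=
  .var .z

abbrev x1 {K : Type} {γ : List Ent} {a : STy} {e1 : Ent} :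
    Tm K (e1 :: .tm a :: γ) a :=
  .var (.s .z)

abbrev x2 {K : Type} {γ : List Ent} {a : STy} {e1 e2 : Ent} :
    Tm K (e1 :: e2 :: .tm a :: γ) a :=
  .var (.s (.s .z))

abbrev x3 {K : Type} {γ : List Ent} {a : STy} {e1 e2 e3 : Ent} :
    Tm K (e1 :: e2 :: e3 :: .tm a :: γ) a :=
  .var (.s (.s (.s .z)))

abbrev x4 {K : Type} {γ : List Ent} {a : STy} {e1 e2 e3 e4 : Ent} :
    Tm K (e1 :: e2 :: e3 :: e4 :: .tm a :: γ) a :=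
  .var (.s (.s (.s (.s .z))))

abbrev x5 {K : Type} {γ : List Ent} {a : STy} {e1 e2 e3 e4 e5 : Ent} :
    Tm K (e1 :: e2 :: e3 :: e4 :: e5 :: .tm a :: γ) a :=
  .var (.s (.s (.s (.s (.s .z)))))

abbrev x6 {K : Type} {γ : List Ent} {a : STy} {e1 e2 e3 e4 e5 e6 : Ent} :
    Tm K (e1 :: e2 :: e3 :: e4 :: e5 :: e6 :: .tm a :: γ) a :=
  .var (.s (.s (.s (.s (.s (.s .z))))))

abbrev x7 {K : Type} {γ : List Ent} {a : STy} {e1 e2 e3 e4 e5 e6 e7 : Ent} :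
    Tm K (e1 :: e2 :: e3 :: e4 :: e5 :: e6 :: e7 :: .tm a :: γ) a :=
  .var (.s (.s (.s (.s (.s (.s (.s .z)))))))

abbrev x8 {K : Type} {γ : List Ent} {a : STy} {e1 e2 e3 e4 e5 e6 e7 e8 : Ent} :
    Tm K (e1 :: e2 :: e3 :: e4 :: e5 :: e6 :: e7 :: e8 :: .tm a :: γ) a :=
  .var (.s (.s (.s (.s (.s (.s (.s (.s .z))))))))

abbrev x9 {K : Type} {γ : List Ent} {a : STy} {e1 e2 e3 e4 e5 e6 e7 e8 e9 : Ent} :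
    Tm K (e1 :: e2 :: e3 :: e4 :: e5 :: e6 :: e7 :: e8 :: e9 :: .tm a :: γ) a :=
  .var (.s (.s (.s (.s (.s (.s (.s (.s (.s .z)))))))))

abbrev x10 {K : Type} {γ : List Ent} {a : STy} {e1 e2 e3 e4 e5 e6 e7 e8 e9 e10 : Ent} :
    Tm K (e1 :: e2 :: e3 :: e4 :: e5 :: e6 :: e7 :: e8 :: e9 :: e10 :: .tm a :: γ) a :=
  .var (.s (.s (.s (.s (.s (.s (.s (.s (.s (.s .z))))))))))

abbrev x11 {K : Type} {γ : List Ent} {a : STy} {e1 e2 e3 e4 e5 e6 e7 e8 e9 e10 e11 : Ent} :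
    Tm K (e1 :: e2 :: e3 :: e4 :: e5 :: e6 :: e7 :: e8 :: e9 :: e10 :: e11 :: .tm a :: γ) a :=
  .var (.s (.s (.s (.s (.s (.s (.s (.s (.s (.s (.s .z)))))))))))

abbrev x12 {K : Type} {γ : List Ent} {a : STy} {e1 e2 e3 e4 e5 e6 e7 e8 e9 e10 e11 e12 : Ent} :
        Tm K (e1 :: e2 :: e3 :: e4 :: e5 :: e6 :: e7 :: e8 :: e9 :: e10 :: e11 :: e12 :: .tm a ::
      γ) a :=
  .var (.s (.s (.s (.s (.s (.s (.s (.s (.s (.s (.s (.s .z))))))))))))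

abbrev x14 {K : Type} {γ : List Ent} {a : STy} {e1 e2 e3 e4 e5 e6 e7 e8 e9 e10 e11 e12 e13 e14 :
      Ent} :
        Tm K (e1 :: e2 :: e3 :: e4 :: e5 :: e6 :: e7 :: e8 :: e9 :: e10 :: e11 :: e12 :: e13 ::
      e14 :: .tm a :: γ) a :=
  .var (.s (.s (.s (.s (.s (.s (.s (.s (.s (.s (.s (.s (.s (.s .z))))))))))))))

abbrev x15 {K : Type} {γ : List Ent} {a : STy} {e1 e2 e3 e4 e5 e6 e7 e8 e9 e10 e11 e12 e13 e14 e15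
      : Ent} :
        Tm K (e1 :: e2 :: e3 :: e4 :: e5 :: e6 :: e7 :: e8 :: e9 :: e10 :: e11 :: e12 :: e13 ::
      e14 :: e15 :: .tm a :: γ) a :=
  .var (.s (.s (.s (.s (.s (.s (.s (.s (.s (.s (.s (.s (.s (.s (.s .z)))))))))))))))

abbrev x16 {K : Type} {γ : List Ent} {a : STy} {e1 e2 e3 e4 e5 e6 e7 e8 e9 e10 e11 e12 e13 e14 e15
      e16 : Ent} :
        Tm K (e1 :: e2 :: e3 :: e4 :: e5 :: e6 :: e7 :: e8 :: e9 :: e10 :: e11 :: e12 :: e13 ::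
      e14 :: e15 :: e16 :: .tm a :: γ) a :=
  .var (.s (.s (.s (.s (.s (.s (.s (.s (.s (.s (.s (.s (.s (.s (.s (.s .z))))))))))))))))

abbrev x17 {K : Type} {γ : List Ent} {a : STy} {e1 e2 e3 e4 e5 e6 e7 e8 e9 e10 e11 e12 e13 e14 e15
      e16 e17 : Ent} :
        Tm K (e1 :: e2 :: e3 :: e4 :: e5 :: e6 :: e7 :: e8 :: e9 :: e10 :: e11 :: e12 :: e13 ::
      e14 :: e15 :: e16 :: e17 :: .tm a :: γ) a :=
  .var (.s (.s (.s (.s (.s (.s (.s (.s (.s (.s (.s (.s (.s (.s (.s (.s (.s .z)))))))))))))))))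

abbrev x18 {K : Type} {γ : List Ent} {a : STy} {e1 e2 e3 e4 e5 e6 e7 e8 e9 e10 e11 e12 e13 e14 e15
      e16 e17 e18 : Ent} :
        Tm K (e1 :: e2 :: e3 :: e4 :: e5 :: e6 :: e7 :: e8 :: e9 :: e10 :: e11 :: e12 :: e13 ::
      e14 :: e15 :: e16 :: e17 :: e18 :: .tm a :: γ) a :=
    .var (.s (.s (.s (.s (.s (.s (.s (.s (.s (.s (.s (.s (.s (.s (.s (.s (.s (.s
      .z))))))))))))))))))

abbrev x22 {K : Type} {γ : List Ent} {a : STy} {e1 e2 e3 e4 e5 e6 e7 e8 e9 e10 e11 e12 e13 e14 e15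
      e16 e17 e18 e19 e20 e21 e22 : Ent} :
        Tm K (e1 :: e2 :: e3 :: e4 :: e5 :: e6 :: e7 :: e8 :: e9 :: e10 :: e11 :: e12 :: e13 ::
      e14 :: e15 :: e16 :: e17 :: e18 :: e19 :: e20 :: e21 :: e22 :: .tm a :: γ) a :=
    .var (.s (.s (.s (.s (.s (.s (.s (.s (.s (.s (.s (.s (.s (.s (.s (.s (.s (.s (.s (.s (.s (.s
      .z))))))))))))))))))))))

/-- The credit term `0`. -/
abbrev c0 {γ : List Ent} : Cr γ := ⟨0, []⟩

/-- The credit term `1`. -/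
abbrev c1 {γ : List Ent} : Cr γ := ⟨1, []⟩

/-- The credit term consisting of a credit variable. -/
abbrev cv {γ : List Ent} (x : Var γ .cred) : Cr γ := ⟨0, [x]⟩

/-- The simple type of the labels of splay trees. -/
abbrev labS : STy := .ex (.bang .key)

/-- The type `∃ α. !^∞_α A` of the labels of splay trees. -/
abbrev labT : Ty := .ex (.bang ⊤ {.bnd 0} .key)

/-- `ℕ ⊸ !^∞_0 ℕ`: numbers are duplicable. -/
def promote {K : Type} {γ : List Ent} : Tm K γ (.lolli .nat (.bang .nat)) :=
  .lam (.nrec x0 (.lam (.save ⊤ c0 .zero))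
    (.save ⊤ c0 (.lam (.letPair 1 x0
      (.transfer 1 ⊤ c0 (.app x0 .unit) (.save ⊤ c0 (.succ x0)))))))

/-- Addition, `ℕ ⊗ ℕ ⊸ ℕ`. -/
def plus {K : Type} {γ : List Ent} : Tm K γ (.lolli (.tensor .nat .nat) .nat) :=
  .lam (.letPair 1 x0 (.nrec x1 (.lam x1)
    (.save ⊤ c0 (.lam (.letPair 1 x0 (.succ (.app x0 .unit)))))))

/-- `phi n = ⌈lg (n + 1)⌉`, of type `ℕ ⊸ ℕ`. The loop computes the pair of `s = ⌈lg (m + 1)⌉` and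
`r = 2 ^ s - 1 - m`; the step from `m` to `m + 1` gives `(s + 1, m)` if `r = 0`, and `(s, r - 1)`
otherwise. -/
def phi {K : Type} {γ : List Ent} : Tm K γ (.lolli .nat .nat) :=
  .lam (.letPair 1
    (.nrec (c := .tensor .nat .nat) x0 (.lam (.pair .zero .zero))
      (.save ⊤ c0 (.lam (.letPair 1 x0 (.letPair 1 (.app x0 .unit)
        (.app
          (.nrec (c := .lolli (.tensor .nat .nat) (.tensor .nat .nat)) x0
            (.lam (.lam (.letPair 1 x0 (.pair (.succ x1) x0))))
            (.save ⊤ c0 (.lam (.letPair 1 x0 (.lam (.letPair 1 x0 (.pair x1 x4)))))))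
          (.pair x1 x3)))))))
    x1)

/-- `ℕ ⊸ ∃ α. !¹_α 1`: creates as many credits as its argument says. -/
def spawn {K : Type} {γ : List Ent} : Tm K γ (.lolli .nat (.ex (.bang .unit))) :=
  .lam (.nrec x0 (.lam (.pack c0 (.save 1 c0 .unit)))
    (.save ⊤ c0 (.lam (.letPair 1 x0 (.create c1 (.unpack (.app x0 .unit)
      (.transfer 1 1 (cv (.s .z)) x0
        (.pack ⟨1, [.s (.s .z)]⟩ (.save 1 ⟨1, [.s (.s .z)]⟩ x0)))))))))

/-- `tree A ⊸ ℕ ⊗ tree A`: reads the cached size, and rebuilds the tree. -/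
def size {K : Type} {γ : List Ent} {a : STy} :
    Tm K γ (.lolli (.tree a) (.tensor .nat (.tree a))) :=
  .lam (.trec x0
    (.save ⊤ c0 (.lam (.pair .zero .emp)))
    (.save ⊤ c0 (.lam (.letPair 1 x0
      (.transfer 1 ⊤ c0 (.app promote x0) (.pair x0 (.node x2 x0 .emp .emp))))))
    (.save ⊤ c0 (.lam (.letPair 1 x0 (.letPair 1 x0 (.letPair 1 x0 (.letPair 1 x0 (.letPair 1 x0
      (.transfer 1 ⊤ c0 (.app promote x7)
        (.pair x0 (.node x10 x0 (.node x6 x4 (.fst x2) (.fst x1)) .emp))))))))))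
    (.save ⊤ c0 (.lam (.letPair 1 x0 (.letPair 1 x0 (.letPair 1 x0 (.letPair 1 x0 (.letPair 1 x0
      (.transfer 1 ⊤ c0 (.app promote x7)
        (.pair x0 (.node x10 x0 .emp (.node x6 x4 (.fst x2) (.fst x1))))))))))))
    (.save ⊤ c0 (.lam (.letPair 1 x0 (.letPair 1 x0 (.letPair 1 x0 (.letPair 1 x0 (.letPair 1 x0
      (.letPair 1 x0 (.letPair 1 x0 (.letPair 1 x0 (.letPair 1 x0
      (.transfer 1 ⊤ c0 (.app promote x15)
        (.pair x0 (.node x18 x0 (.node x14 x12 (.fst x10) (.fst x8))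
          (.node x6 x4 (.fst x2) (.fst x1)))))))))))))))))

/-- `!^∞_0 A ⊗ (tree ⊗ tree) ⊸ tree`: builds a node from a key and two subtrees, computing its size
`n` from the sizes of the subtrees, and creating `phi n` credits that are stored with the key. -/
def mk {K : Type} {γ : List Ent} :
    Tm K γ (.lolli (.tensor (.bang .key) (.tensor (.tree labS) (.tree labS))) (.tree labS)) :=
  .lam (.letPair 1 x0 (.letPair 1 x0
    (.letPair 1 (.app size x1) (.letPair 1 (.app size x2)
      (.transfer 1 ⊤ c0 (.app promote (.succ (.app plus (.pair x3 x1))))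
        (.unpack (.app spawn (.app phi x0))
          (.transfer 1 1 (cv (.s .z)) x0
            (.transfer 1 ⊤ c0 x11
              (.node (.pack (cv (.s (.s (.s .z)))) (.save ⊤ (cv (.s (.s (.s .z)))) x0))
                x4 x7 x5)))))))))

/-- The case of `split` where the pivot `p` is at most the root `x`, and the left child of the root
is a node `y` with subtrees `k₁` and `k₂`; `r` is the right subtree of the root. The argument is
`(p, x, y, k₁, k₂, r)`. The credits stored with `x` and `y` are spent. If `p ≤ y`, and
`(small, big)` is the result of splitting `k₁`, the result is `(small, N (y, big, N (x, k₂, r)))`;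
otherwise, if `(small, big)` is the result of splitting `k₂`, it is
`(N (y, k₁, small), N (x, big, r))`. -/
def goLeft {K : Type} {γ : List Ent} :
    Tm K γ (.lolli (.tensor (.bang .key) (.tensor labS (.tensor labS
      (.tensor (.wth (.tree labS) (.tensor (.tree labS) (.tree labS)))
      (.tensor (.wth (.tree labS) (.tensor (.tree labS) (.tree labS))) (.tree labS))))))
      (.tensor (.tree labS) (.tree labS))) :=
  .lam (.letPair 1 x0 (.letPair 1 x0 (.letPair 1 x0 (.letPair 1 x0 (.letPair 1 x0
    (.transfer 1 ⊤ c0 x9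
    (.unpack x8 (.transfer 1 ⊤ (cv (.s .z)) x0
    (.unpack x9 (.transfer 1 ⊤ (cv (.s .z)) x0
    (.spend (cv (.s (.s (.s (.s (.s .z)))))) (.spend (cv (.s (.s .z)))
    (.ifLe x6 x0
      (.letPair 1 (.snd x10)
        (.pair x1 (.app mk (.pair (.save ⊤ c0 x2)
          (.pair x0 (.app mk (.pair (.save ⊤ c0 x5) (.pair (.fst x10) x9))))))))
      (.letPair 1 (.snd x8)
        (.pair (.app mk (.pair (.save ⊤ c0 x2) (.pair (.fst x12) x1)))
          (.app mk (.pair (.save ⊤ c0 x5) (.pair x0 x9))))))))))))))))))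

/-- The case of `split` where the pivot `p` is greater than the root `x`, and the right child of the
root is a node `z` with subtrees `k₁` and `k₂`; `l` is the left subtree of the root. The argument is
`(p, x, z, k₁, k₂, l)`. The credits stored with `x` and `z` are spent. If `p ≤ z`, and
`(small, big)` is the result of splitting `k₁`, the result is `(N (x, l, small), N (z, big, k₂))`;
otherwise, if `(small, big)` is the result of splitting `k₂`, it is
`(N (z, N (x, l, k₁), small), big)`. -/
def goRight {K : Type} {γ : List Ent} :
    Tm K γ (.lolli (.tensor (.bang .key) (.tensor labS (.tensor labS
      (.tensor (.wth (.tree labS) (.tensor (.tree labS) (.tree labS)))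
      (.tensor (.wth (.tree labS) (.tensor (.tree labS) (.tree labS))) (.tree labS))))))
      (.tensor (.tree labS) (.tree labS))) :=
  .lam (.letPair 1 x0 (.letPair 1 x0 (.letPair 1 x0 (.letPair 1 x0 (.letPair 1 x0
    (.transfer 1 ⊤ c0 x9
    (.unpack x8 (.transfer 1 ⊤ (cv (.s .z)) x0
    (.unpack x9 (.transfer 1 ⊤ (cv (.s .z)) x0
    (.spend (cv (.s (.s (.s (.s (.s .z)))))) (.spend (cv (.s (.s .z)))
    (.ifLe x6 x0
      (.letPair 1 (.snd x10)
        (.pair (.app mk (.pair (.save ⊤ c0 x5) (.pair x9 x1)))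
          (.app mk (.pair (.save ⊤ c0 x2) (.pair x0 (.fst x10))))))
      (.letPair 1 (.snd x8)
        (.pair (.app mk (.pair (.save ⊤ c0 x2)
          (.pair (.app mk (.pair (.save ⊤ c0 x5) (.pair x9 (.fst x12)))) x1))) x0)))))))))))))))

/-- Stores the credits of the credit variable with index `2` with the key with index `0`. -/
abbrev restore {K : Type} {γ : List Ent} {e : Ent} : Tm K (.tm .key :: e :: .cred :: γ) labS :=
  .pack (cv (.s (.s .z))) (.save ⊤ (cv (.s (.s .z))) x0)

/-- `split : !^∞_0 A ⊗ tree (∃ α. !^∞_α A) ⊸ tree (∃ α. !^∞_α A) ⊗ tree (∃ α. !^∞_α A)` splits a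
tree into the tree of the keys below the pivot and the tree of the other keys. Every call of the
recursion incurs one `tick`. -/
def split {K : Type} {γ : List Ent} :
    Tm K γ (.lolli (.tensor (.bang .key) (.tree labS)) (.tensor (.tree labS) (.tree labS))) :=
  .lam (.letPair 1 x0 (.transfer 1 ⊤ c0 x1 (.trec x1
    (.save ⊤ c0 (.lam (.tick (.pair .emp .emp))))
    (.save ⊤ c0 (.lam (.tick (.letPair 1 x0
      (.unpack x1 (.transfer 1 ⊤ (cv (.s .z)) x0 (.ifLe x6 x0
        (.pair .emp (.node restore x3 .emp .emp))
        (.pair (.node restore x3 .emp .emp) .emp))))))))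
    (.save ⊤ c0 (.lam (.tick
      (.letPair 1 x0 (.letPair 1 x0 (.letPair 1 x0 (.letPair 1 x0 (.letPair 1 x0
      (.unpack x9 (.transfer 1 ⊤ (cv (.s .z)) x0 (.ifLe x14 x0
        (.app goLeft (.pair (.save ⊤ c0 x14)
          (.pair restore
          (.pair x8 (.pair x4 (.pair x3 .emp))))))
        (.pair (.node restore x10
          (.node x8 x6 (.fst x4) (.fst x3)) .emp) .emp))))))))))))
    (.save ⊤ c0 (.lam (.tick
      (.letPair 1 x0 (.letPair 1 x0 (.letPair 1 x0 (.letPair 1 x0 (.letPair 1 x0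
      (.unpack x9 (.transfer 1 ⊤ (cv (.s .z)) x0 (.ifLe x14 x0
        (.pair .emp (.node restore x10
          .emp (.node x8 x6 (.fst x4) (.fst x3))))
        (.app goRight (.pair (.save ⊤ c0 x14)
          (.pair restore
          (.pair x8 (.pair x4 (.pair x3 .emp)))))))))))))))))
    (.save ⊤ c0 (.lam (.tick
      (.letPair 1 x0 (.letPair 1 x0 (.letPair 1 x0 (.letPair 1 x0 (.letPair 1 x0
      (.letPair 1 x0 (.letPair 1 x0 (.letPair 1 x0 (.letPair 1 x0
      (.unpack x17 (.transfer 1 ⊤ (cv (.s .z)) x0 (.ifLe x22 x0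
        (.app goLeft (.pair (.save ⊤ c0 x22)
          (.pair restore
          (.pair x16 (.pair x12 (.pair x10 (.node x8 x6 (.fst x4) (.fst x3))))))))
        (.app goRight (.pair (.save ⊤ c0 x22)
          (.pair restore
          (.pair x8 (.pair x4 (.pair x3 (.node x16 x14 (.fst x12) (.fst x10)))))))))))))))))))))))
    )))

/-- The term `split(t, v)`. -/
def splitAt {K : Type} (t : Tm K [] (.tree labS)) (v : K) :
    Tm K [] (.tensor (.tree labS) (.tree labS)) :=
  .app split (.pair (.save ⊤ c0 (.key v)) t)

/-- `⟦‖size(t)‖_p⟧`, the size component. -/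
noncomputable def sizeDen {K : Type} [LinearOrder K] (t : Tm K [] (.tree labS)) : Flat ℕ :=
  ((Tm.app size t).potDen : Flat ℕ × TreeDom (Flat ℕ × Flat K) (Flat ℕ)).1

/-- `φ(n) = ⌈lg (n + 1)⌉`. -/
noncomputable def credits (n : ℕ) : ℕ := ⌈Real.logb 2 ((n : ℝ) + 1)⌉₊

/-- `φ` on `ℕ ∪ {∞}`. -/
noncomputable def creditsDen : Flat ℕ → WithTop ℤ
  | .val n => ((credits n : ℤ) : WithTop ℤ)
  | .inf => ⊤

/-- The number of nodes. -/
def TreeDom.nodes {α β : Type} : TreeDom α β → ℕ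
  | inf => 0
  | emp => 0
  | node _ _ l r => l.nodes + r.nodes + 1

/-- All keys of the tree are finite and satisfy `P`. -/
def TreeDom.AllKeys {K : Type} (P : K → Prop) : TreeDom (Flat ℕ × Flat K) (Flat ℕ) → Prop
  | inf => False
  | emp => True
  | node (_, .val x) _ l r => P x ∧ l.AllKeys P ∧ r.AllKeys P
  | node (_, .inf) _ _ _ => False

/-- Splay trees, by their denotations: binary search trees in which every node caches the size `n`
of the subtree at that node, and stores `φ(n)` credits. -/
def IsSplay {K : Type} [LinearOrder K] : TreeDom (Flat ℕ × Flat K) (Flat ℕ) → Prop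
  | .emp => True
  | .node (.val α, .val x) (.val n) l r =>
      n = l.nodes + r.nodes + 1 ∧ α = credits n ∧ l.AllKeys (· ≤ x) ∧ r.AllKeys (x ≤ ·) ∧
        IsSplay l ∧ IsSplay r
  | _ => False


/-! ## Typing of the programs

The typing derivations below compute resource terms with finitely many coefficients. -/

/-- The resource term with bank `b` and the coefficients listed in `l`. -/
def Res.ofList (b : ℕ∞) (l : List ℕ∞) : Res := (b, fun i => l.getD i 0)

/-- Coefficientwise sum, with missing coefficients read as `0`. -/
def addL : List ℕ∞ → List ℕ∞ → List ℕ∞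
  | [], l => l
  | l, [] => l
  | a :: l, b :: m => (a + b) :: addL l m

/-- Coefficientwise maximum, with missing coefficients read as `0`. -/
noncomputable def maxL : List ℕ∞ → List ℕ∞ → List ℕ∞
  | [], l => l
  | l, [] => l
  | a :: l, b :: m => max a b :: maxL l m

/-- The coefficients of a single variable. -/
def oneL : ℕ → List ℕ∞
  | 0 => [1]
  | n + 1 => 0 :: oneL n

/-- Removes one use of a variable. -/
def decL : ℕ → List ℕ∞ → List ℕ∞
  | _, [] => []
  | 0, a :: l => (a - 1) :: l
  | n + 1, a :: l => a :: decL n l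

theorem getD_addL (l m : List ℕ∞) (i : ℕ) :
    (addL l m).getD i 0 = l.getD i 0 + m.getD i 0 := by
  induction l, m using addL.induct generalizing i with
  | case1 l => simp [addL]
  | case2 l h => cases l <;> simp [addL]
  | case3 a l b m ih => cases i <;> simp_all [addL]

theorem getD_maxL_left (l m : List ℕ∞) (i : ℕ) : l.getD i 0 ≤ (maxL l m).getD i 0 := by
  induction l, m using maxL.induct generalizing i with
  | case1 l => simp [maxL]
  | case2 l h => cases l <;> simp [maxL]
  | case3 a l b m ih => cases i <;> simp_all [maxL]

theorem getD_maxL_right (l m : List ℕ∞) (i : ℕ) : m.getD i 0 ≤ (maxL l m).getD i 0 := by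
  induction l, m using maxL.induct generalizing i with
  | case1 l => simp [maxL]
  | case2 l h => cases l <;> simp [maxL]
  | case3 a l b m ih => cases i <;> simp_all [maxL]

theorem getD_oneL (n i : ℕ) : (oneL n).getD i 0 = if n = i then 1 else 0 := by
  induction n generalizing i with
  | zero => cases i <;> simp [oneL]
  | succ n ih => cases i <;> simp_all [oneL]

theorem getD_decL (n : ℕ) (l : List ℕ∞) (i : ℕ) :
    l.getD i 0 ≤ (decL n l).getD i 0 + if n = i then 1 else 0 := by
  induction n, l using decL.induct generalizing i with
  | case1 => simp [decL]
  | case2 a l => cases i <;> simp [decL, le_tsub_add]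
  | case3 n a l ih => cases i <;> simp_all [decL]

/-- `Γ ⊢_f M : A` for the resource term `f` with bank `b` and coefficients `l`. -/
def HasTyL {K : Type} {γ : List Ent} {a : STy} (Γ : Ctx) (b : ℕ∞) (l : List ℕ∞) (M : Tm K γ a)
    (A : Ty) : Prop :=
  HasTy Γ (Res.ofList b l) M A

namespace HasTyL

variable {K : Type} {γ : List Ent} {a a' c : STy} {Γ : Ctx} {b b' : ℕ∞} {l l' : List ℕ∞}
  {A B C : Ty}

theorem ofList_add : Res.ofList b l + Res.ofList b' l' = Res.ofList (b + b') (addL l l') := by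
  ext i
  · rfl
  · exact (getD_addL l l' i).symm

theorem ofList_smul (k : ℕ∞) : k • Res.ofList b l = Res.ofList (k * b) (l.map (k * ·)) := by
  ext i
  · rfl
  · simp [Res.ofList, List.getD_eq_getElem?_getD]
    cases l[i]? <;> simp

theorem toRes_c0 : (c0 : Cr γ).toRes = 0 := by
  ext i <;> simp [Cr.toRes]

theorem toRes_cv (x : Var γ .cred) : (cv x).toRes = Res.ofList 0 (oneL x.idx) := by
  ext i
  · simp [Cr.toRes, Res.ofList]
  · simp [Cr.toRes, Res.ofList, -List.getD_eq_getElem?_getD, getD_oneL, List.countP_cons]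

theorem toRes_c1 : (c1 : Cr γ).toRes = Res.ofList 1 [] := by
  ext i <;> simp [Cr.toRes, Res.ofList]

theorem toRes_succ (x : Var γ .cred) :
    (⟨1, [x]⟩ : Cr γ).toRes = Res.ofList 1 (oneL x.idx) := by
  ext i
  · simp [Cr.toRes, Res.ofList]
  · simp [Cr.toRes, Res.ofList, -List.getD_eq_getElem?_getD, getD_oneL, List.countP_cons]

theorem le_cons (k : ℕ∞) (h : l.headD 0 ≤ k) :
    Res.ofList b l ≤ Res.cons k (Res.ofList b l.tail) := by
  refine ⟨le_rfl, fun i => ?_⟩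
  cases l <;> cases i <;> simp_all [Res.ofList, Res.cons]

theorem cons_mono {k k' : ℕ∞} {f g : Res} (h : k ≤ k') (h' : f ≤ g) :
    Res.cons k f ≤ Res.cons k' g := by
  refine ⟨h'.1, fun i => ?_⟩
  cases i
  · exact h
  · exact h'.2 _

theorem le_dec (x : ℕ) : Res.ofList b l ≤ Res.ofList b (decL x l) + Res.ofList 0 (oneL x) := by
  refine ⟨by simp [Res.ofList], fun i => ?_⟩
  simpa [Res.ofList, -List.getD_eq_getElem?_getD, getD_oneL] using getD_decL x l i

theorem var {x : Var γ (.tm a)} (h : Γ[x.idx]? = some (some A)) :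
    HasTyL Γ 0 (oneL x.idx) (.var x : Tm K γ a) A := by
  refine (HasTy.var h).weaken ⟨le_rfl, fun i => ?_⟩
  by_cases hi : x.idx = i
  · subst hi; simp [Res.ofList, -List.getD_eq_getElem?_getD, getD_oneL]
  · simp [Res.ofList, -List.getD_eq_getElem?_getD, getD_oneL, hi, Ne.symm hi]

theorem tick {M : Tm K γ a} (h : HasTyL Γ b l M A) : HasTyL Γ b l (.tick M) A := HasTy.tick h

theorem create1 {M : Tm K γ a} (h : HasTyL Γ b l M A) : HasTyL Γ (b - 1) l (.create c1 M) A := by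
  refine HasTy.create (h.weaken ?_)
  rw [toRes_c1, ofList_add]
  exact ⟨le_tsub_add, fun i => by simp [Res.ofList, -List.getD_eq_getElem?_getD, getD_addL]⟩

theorem spend {x : Var γ .cred} {M : Tm K γ a} (h : HasTyL Γ b l M A) :
    HasTyL Γ b (addL l (oneL x.idx)) (.spend (cv x) M) A := by
  have := HasTy.spend (c := cv x) h
  rw [toRes_cv, ofList_add] at this
  simpa [HasTyL] using this

theorem save0 {k : ℕ∞} {M : Tm K γ a} (hk : k ≠ 0) (h : HasTyL Γ b l M A) :
    HasTyL Γ (k * b) (l.map (k * ·)) (.save k c0 M) (.bang k 0 A) := by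
  have := HasTy.save (c := c0) hk h
  rw [toRes_c0, ofList_smul, add_zero] at this
  exact this

theorem saveV {k : ℕ∞} {x : Var γ .cred} {M : Tm K γ a} (hk : k ≠ 0) (h : HasTyL Γ b l M A) :
    HasTyL Γ (k * b) (addL (l.map (k * ·)) (oneL x.idx)) (.save k (cv x) M)
      (.bang k {.free (Γ.length - 1 - x.idx)} A) := by
  have := HasTy.save (c := cv x) hk h
  rw [toRes_cv, ofList_smul, ofList_add, add_zero] at this
  exact this

theorem saveS {k : ℕ∞} {x : Var γ .cred} {M : Tm K γ a} (hk : k ≠ 0) (h : HasTyL Γ b l M A) :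
    HasTyL Γ (k * b + 1) (addL (l.map (k * ·)) (oneL x.idx)) (.save k ⟨1, [x]⟩ M)
      (.bang k ({.one} + {.free (Γ.length - 1 - x.idx)}) A) := by
  have := HasTy.save (c := ⟨1, [x]⟩) hk h
  rw [toRes_succ, ofList_smul, ofList_add] at this
  exact this

theorem transfer0 {k : ℕ∞} {M : Tm K γ (.bang a)} {N : Tm K (.tm a :: γ) c}
    (hM : HasTyL Γ b l M (.bang k 0 A)) (hN : HasTyL (some A :: Γ) b' l' N C)
    (hk : l'.headD 0 ≤ k) : HasTyL Γ (b + b') (addL l l'.tail) (.transfer 1 k c0 M N) C := by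
  have := HasTy.transfer (k' := 1) (k := k) (e := c0) (g := Res.ofList b' l'.tail) one_ne_zero hM
    (hN.weaken (by rw [toRes_c0]; simpa using le_cons k hk))
  rw [one_smul, ofList_add] at this
  exact this

theorem transferV {k : ℕ∞} {x : Var γ .cred} {M : Tm K γ (.bang a)} {N : Tm K (.tm a :: γ) c}
    (hM : HasTyL Γ b l M (.bang k {.free (Γ.length - 1 - x.idx)} A))
    (hN : HasTyL (some A :: Γ) b' l' N C) (hk : l'.headD 0 ≤ k) :
    HasTyL Γ (b + b') (addL l (decL x.idx l'.tail)) (.transfer 1 k (cv x) M N) C := by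
  have := HasTy.transfer (k' := 1) (k := k) (e := cv x) (g := Res.ofList b' (decL x.idx l'.tail))
    one_ne_zero hM (hN.weaken (by
      rw [toRes_cv, one_mul, one_smul]
      exact (le_cons k hk).trans (cons_mono le_rfl (le_dec _))))
  rw [one_smul, ofList_add] at this
  exact this

theorem unit : HasTyL Γ 0 [] (.unit : Tm K γ _) .unit := HasTy.unit

theorem pair {M : Tm K γ a} {N : Tm K γ a'} (hM : HasTyL Γ b l M A) (hN : HasTyL Γ b' l' N B) :
    HasTyL Γ (b + b') (addL l l') (.pair M N) (.tensor A B) := by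
  have := HasTy.pair hM hN
  rwa [ofList_add] at this

theorem letPair {M : Tm K γ (.tensor a a')} {N : Tm K (.tm a' :: .tm a :: γ) c}
    (hM : HasTyL Γ b l M (.tensor A B)) (hN : HasTyL (some B :: some A :: Γ) b' l' N C)
    (h : l'.headD 0 ≤ 1) (h' : l'.tail.headD 0 ≤ 1) :
    HasTyL Γ (b + b') (addL l l'.tail.tail) (.letPair 1 M N) C := by
  have := HasTy.letPair (k' := 1) (g := Res.ofList b' l'.tail.tail) one_ne_zero hM
    (hN.weaken ((le_cons 1 h).trans (cons_mono le_rfl (le_cons 1 h'))))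
  rw [one_smul, ofList_add] at this
  exact this

theorem lam {M : Tm K (.tm a :: γ) c} (hA : A.shape = a) (hA' : A.WF Γ 0)
    (hM : HasTyL (some A :: Γ) b l M B) (h : l.headD 0 ≤ 1) :
    HasTyL Γ b l.tail (.lam M) (.lolli A B) :=
  HasTy.lam hA hA' (hM.weaken (le_cons 1 h))

theorem app {M : Tm K γ (.lolli a a')} {N : Tm K γ a} (hM : HasTyL Γ b l M (.lolli A B))
    (hN : HasTyL Γ b' l' N A) : HasTyL Γ (b + b') (addL l l') (.app M N) B := by
  have := HasTy.app hM hN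
  rwa [ofList_add] at this

theorem fst {M : Tm K γ (.wth a a')} (hM : HasTyL Γ b l M (.wth A B)) :
    HasTyL Γ b l (.fst M) A := HasTy.fst hM

theorem snd {M : Tm K γ (.wth a a')} (hM : HasTyL Γ b l M (.wth A B)) :
    HasTyL Γ b l (.snd M) B := HasTy.snd hM

theorem zero : HasTyL Γ 0 [] (.zero : Tm K γ _) .nat := HasTy.zero

theorem succ {M : Tm K γ .nat} (hM : HasTyL Γ b l M .nat) : HasTyL Γ b l (.succ M) .nat :=
  HasTy.succ hM

theorem nrec {b'' : ℕ∞} {l'' : List ℕ∞} {M : Tm K γ .nat} {N₁ : Tm K γ (.lolli .unit c)}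
    {N₂ : Tm K γ (.bang (.lolli (.tensor .nat (.lolli .unit c)) c))}
    (hM : HasTyL Γ b l M .nat) (h₁ : HasTyL Γ b' l' N₁ (.lolli .unit C))
    (h₂ : HasTyL Γ b'' l'' N₂ (.bang ⊤ 0 (.lolli (.tensor .nat (.lolli .unit C)) C))) :
    HasTyL Γ (b + b' + b'') (addL (addL l l') l'') (.nrec M N₁ N₂) C := by
  have := HasTy.nrec hM h₁ h₂
  rwa [ofList_add, ofList_add] at this

theorem ifLe {b₁ b₂ : ℕ∞} {l₁ l₂ : List ℕ∞} {M N : Tm K γ .key} {P Q : Tm K γ c}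
    (hM : HasTyL Γ b l M .key) (hN : HasTyL Γ b' l' N .key) (hP : HasTyL Γ b₁ l₁ P C)
    (hQ : HasTyL Γ b₂ l₂ Q C) :
    HasTyL Γ (b + b' + max b₁ b₂) (addL (addL l l') (maxL l₁ l₂)) (.ifLe M N P Q) C := by
  have := HasTy.ifLe hM hN
    (hP.weaken (g := Res.ofList (max b₁ b₂) (maxL l₁ l₂))
      ⟨le_max_left _ _, getD_maxL_left l₁ l₂⟩)
    (hQ.weaken ⟨le_max_right _ _, getD_maxL_right l₁ l₂⟩)
  rwa [ofList_add, ofList_add] at this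

theorem emp (hA : A.shape = a) (hA' : A.WF Γ 0) :
    HasTyL Γ 0 [] (.emp : Tm K γ (.tree a)) (.tree A) := HasTy.emp hA hA'

theorem node {b₁ b₂ : ℕ∞} {l₁ l₂ : List ℕ∞} {M : Tm K γ a} {N : Tm K γ .nat}
    {L R : Tm K γ (.tree a)} (hM : HasTyL Γ b l M A) (hN : HasTyL Γ b' l' N .nat)
    (hL : HasTyL Γ b₁ l₁ L (.tree A)) (hR : HasTyL Γ b₂ l₂ R (.tree A)) :
    HasTyL Γ (b + b' + b₁ + b₂) (addL (addL (addL l l') l₁) l₂) (.node M N L R) (.tree A) := by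
  have := HasTy.node hM hN hL hR
  rwa [ofList_add, ofList_add, ofList_add] at this

theorem trec {b₀ b₁ b₂ b₃ b₄ : ℕ∞} {l₀ l₁ l₂ l₃ l₄ : List ℕ∞} {M : Tm K γ (.tree a)}
    {N₀ : Tm K γ (.bang (.lolli .unit c))}
    {N₁ : Tm K γ (.bang (.lolli (.tensor a .nat) c))}
    {N₂ N₃ : Tm K γ (.bang (.lolli (.tensor a (.tensor .nat (.tensor a (.tensor .nat
      (.tensor (.wth (.tree a) c) (.wth (.tree a) c)))))) c))}
    {N₄ : Tm K γ (.bang (.lolli (.tensor a (.tensor .nat (.tensor a (.tensor .nat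
      (.tensor (.wth (.tree a) c) (.tensor (.wth (.tree a) c) (.tensor a (.tensor .nat
      (.tensor (.wth (.tree a) c) (.wth (.tree a) c)))))))))) c))}
    (hM : HasTyL Γ b l M (.tree A))
    (h₀ : HasTyL Γ b₀ l₀ N₀ (.bang ⊤ 0 (.lolli .unit C)))
    (h₁ : HasTyL Γ b₁ l₁ N₁ (.bang ⊤ 0 (.lolli (.tensor A .nat) C)))
    (h₂ : HasTyL Γ b₂ l₂ N₂ (.bang ⊤ 0 (.lolli (.tensor A (.tensor .nat (.tensor A (.tensor .nat
        (.tensor (.wth (.tree A) C) (.wth (.tree A) C)))))) C)))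
    (h₃ : HasTyL Γ b₃ l₃ N₃ (.bang ⊤ 0 (.lolli (.tensor A (.tensor .nat (.tensor A (.tensor .nat
        (.tensor (.wth (.tree A) C) (.wth (.tree A) C)))))) C)))
    (h₄ : HasTyL Γ b₄ l₄ N₄ (.bang ⊤ 0 (.lolli (.tensor A (.tensor .nat (.tensor A (.tensor .nat
        (.tensor (.wth (.tree A) C) (.tensor (.wth (.tree A) C) (.tensor A (.tensor .nat
        (.tensor (.wth (.tree A) C) (.wth (.tree A) C)))))))))) C))) :
    HasTyL Γ (b + b₀ + b₁ + b₂ + b₃ + b₄) (addL (addL (addL (addL (addL l l₀) l₁) l₂) l₃) l₄)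
      (.trec M N₀ N₁ N₂ N₃ N₄) C := by
  have := HasTy.trec hM h₀ h₁ h₂ h₃ h₄
  rwa [ofList_add, ofList_add, ofList_add, ofList_add, ofList_add] at this

theorem packV {k : ℕ∞} {x : Var γ .cred} {M : Tm K γ (.bang a)}
    (hM : HasTyL Γ b l M (.bang k {.free (Γ.length - 1 - x.idx)} .key)) :
    HasTyL Γ b l (.pack (cv x) M) (.ex (.bang k {.bnd 0} .key)) := HasTy.pack hM

theorem unpackB {k : ℕ∞} {M : Tm K γ (.ex (.bang a))} {N : Tm K (.tm (.bang a) :: .cred :: γ) c}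
    (hA : ∀ e, A.inst e 0 = A) (hC : C.WF Γ 0) (hM : HasTyL Γ b l M (.ex (.bang k {.bnd 0} A)))
    (hN : HasTyL (some (.bang k {.free Γ.length} A) :: none :: Γ) b' l' N C)
    (h : l'.headD 0 ≤ 1) (h' : l'.tail.headD 0 ≤ 0) :
    HasTyL Γ (b + b') (addL l l'.tail.tail) (.unpack M N) C := by
  have := HasTy.unpack (g := Res.ofList b' l'.tail.tail) hC hM (by
    have h2 := hN.weaken ((le_cons 1 h).trans (cons_mono le_rfl (le_cons 0 h')))
    have h3 : Ty.inst {CAtom.free Γ.length} 0 (.bang k {.bnd 0} A)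
        = .bang k {.free Γ.length} A := by simp [Ty.inst, hA]
    rwa [h3])
  rw [ofList_add] at this
  exact this

theorem toZero {M : Tm K γ a} (h : HasTyL Γ b l M A) (hb : b = 0) (hl : ∀ x ∈ l, x = 0) :
    HasTyL Γ 0 [] M A := by
  refine h.weaken ⟨hb.le, fun i => ?_⟩
  have : l.getD i 0 = 0 := by
    rw [List.getD_eq_getElem?_getD]
    rcases hi : l[i]? with _ | x
    · rfl
    · exact hl _ (List.mem_of_getElem? hi)
  simp [Res.ofList, -List.getD_eq_getElem?_getD, this]

end HasTyL


theorem promote_ty {K : Type} {γ : List Ent} (Γ : Ctx) :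
    HasTyL Γ 0 [] (promote : Tm K γ _) (.lolli .nat (.bang ⊤ 0 .nat)) := by
  unfold promote
  apply HasTyL.toZero
  · repeat' first
      | exact HasTyL.var rfl
      | with_reducible first
        | apply HasTyL.lam
        | apply HasTyL.app
        | apply HasTyL.letPair
        | apply HasTyL.transfer0
        | apply HasTyL.save0
        | apply HasTyL.nrec
        | apply HasTyL.unit
        | apply HasTyL.zero
        | apply HasTyL.succ
    all_goals first | simp [Ty.WF, oneL, addL, Var.idx] | rfl
  all_goals simp [oneL, addL, Var.idx]

theorem plus_ty {K : Type} {γ : List Ent} (Γ : Ctx) :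
    HasTyL Γ 0 [] (plus : Tm K γ _) (.lolli (.tensor .nat .nat) .nat) := by
  unfold plus
  apply HasTyL.toZero
  · repeat' first
      | exact HasTyL.var rfl
      | with_reducible first
        | apply HasTyL.lam
        | apply HasTyL.app
        | apply HasTyL.letPair
        | apply HasTyL.save0
        | apply HasTyL.nrec
        | apply HasTyL.unit
        | apply HasTyL.succ
    all_goals first | simp [Ty.WF, oneL, addL, Var.idx] | rfl
  all_goals simp [oneL, addL, Var.idx]

theorem phi_ty {K : Type} {γ : List Ent} (Γ : Ctx) :
    HasTyL Γ 0 [] (phi : Tm K γ _) (.lolli .nat .nat) := by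
  unfold phi
  apply HasTyL.toZero
  · repeat' first
      | exact HasTyL.var rfl
      | with_reducible first
        | apply HasTyL.lam
        | apply HasTyL.app
        | apply HasTyL.letPair
        | apply HasTyL.save0
        | apply HasTyL.nrec
        | apply HasTyL.pair
        | apply HasTyL.unit
        | apply HasTyL.zero
        | apply HasTyL.succ
    all_goals first | simp [Ty.WF, oneL, addL, Var.idx] | rfl
  all_goals simp [oneL, addL, Var.idx]

theorem packS_ty {K : Type} {γ : List Ent} {Γ : Ctx} {b : ℕ∞} {l : List ℕ∞} {x : Var γ .cred}
    {M : Tm K γ (.bang .unit)}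
    (hM : HasTyL Γ b l M (.bang 1 ({.one} + {.free (Γ.length - 1 - x.idx)}) .unit)) :
    HasTyL Γ b l (.pack ⟨1, [x]⟩ M) (.ex (.bang 1 {.bnd 0} .unit)) := HasTy.pack hM

theorem pack0_ty {K : Type} {γ : List Ent} {Γ : Ctx} {b : ℕ∞} {l : List ℕ∞}
    {M : Tm K γ (.bang .unit)} (hM : HasTyL Γ b l M (.bang 1 0 .unit)) :
    HasTyL Γ b l (.pack c0 M) (.ex (.bang 1 {.bnd 0} .unit)) := HasTy.pack hM

theorem spawn_ty {K : Type} {γ : List Ent} (Γ : Ctx) :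
    HasTyL Γ 0 [] (spawn : Tm K γ _) (.lolli .nat (.ex (.bang 1 {.bnd 0} .unit))) := by
  unfold spawn
  apply HasTyL.toZero
  · repeat' first
      | exact HasTyL.var rfl
      | with_reducible first
        | apply HasTyL.lam
        | apply HasTyL.app
        | apply HasTyL.letPair
        | apply HasTyL.save0
        | apply HasTyL.saveS
        | apply packS_ty
        | apply pack0_ty
        | apply HasTyL.unpackB
        | apply HasTyL.create1
        | apply HasTyL.transferV
        | apply HasTyL.nrec
        | apply HasTyL.pair
        | apply HasTyL.unit
        | apply HasTyL.zero
        | apply HasTyL.succ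
    all_goals first | simp [Ty.WF, Ty.inst, oneL, addL, decL, Var.idx] | rfl
  all_goals simp [oneL, addL, decL, Var.idx]


theorem size_ty {K : Type} {γ : List Ent} (Γ : Ctx) :
    HasTyL Γ 0 [] (size : Tm K γ (.lolli (.tree labS) _))
      (.lolli (.tree labT) (.tensor .nat (.tree labT))) := by
  unfold size
  apply HasTyL.toZero
  · repeat' first
      | exact HasTyL.var rfl
      | exact promote_ty _
      | with_reducible first
        | apply HasTyL.lam
        | apply HasTyL.app
        | apply HasTyL.letPair
        | apply HasTyL.save0
        | apply HasTyL.transfer0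
        | apply HasTyL.trec
        | apply HasTyL.pair
        | apply HasTyL.emp
        | apply HasTyL.node
        | apply HasTyL.fst
        | apply HasTyL.zero
    all_goals first | simp [Ty.WF, oneL, addL, Var.idx] | rfl
  all_goals simp [oneL, addL, Var.idx]

theorem mk_ty {K : Type} {γ : List Ent} (Γ : Ctx) :
    HasTyL Γ 0 [] (mk : Tm K γ _)
      (.lolli (.tensor (.bang ⊤ 0 .key) (.tensor (.tree labT) (.tree labT))) (.tree labT)) := by
  unfold mk
  apply HasTyL.toZero
  · repeat' first
      | exact HasTyL.var rfl
      | exact promote_ty _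
      | exact plus_ty _
      | exact phi_ty _
      | exact spawn_ty _
      | exact size_ty _
      | with_reducible first
        | apply HasTyL.lam
        | apply HasTyL.app
        | apply HasTyL.letPair
        | apply HasTyL.saveV
        | apply HasTyL.transfer0
        | apply HasTyL.transferV
        | apply HasTyL.unpackB
        | apply HasTyL.packV
        | apply HasTyL.pair
        | apply HasTyL.succ
        | apply HasTyL.node
    all_goals first | simp [Ty.WF, Ty.inst, oneL, addL, decL, Var.idx] | rfl
  all_goals simp [oneL, addL, decL, Var.idx]

theorem goLeft_ty {K : Type} {γ : List Ent} (Γ : Ctx) :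
    HasTyL Γ 0 [] (goLeft : Tm K γ _)
      (.lolli (.tensor (.bang ⊤ 0 .key) (.tensor labT (.tensor labT
      (.tensor (.wth (.tree labT) (.tensor (.tree labT) (.tree labT)))
      (.tensor (.wth (.tree labT) (.tensor (.tree labT) (.tree labT))) (.tree labT))))))
      (.tensor (.tree labT) (.tree labT))) := by
  unfold goLeft
  apply HasTyL.toZero
  · repeat' first
      | exact HasTyL.var rfl
      | exact mk_ty _
      | with_reducible first
        | apply HasTyL.lam
        | apply HasTyL.app
        | apply HasTyL.letPair
        | apply HasTyL.save0
        | apply HasTyL.transfer0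
        | apply HasTyL.transferV
        | apply HasTyL.unpackB
        | apply HasTyL.spend
        | apply HasTyL.ifLe
        | apply HasTyL.pair
        | apply HasTyL.fst
        | apply HasTyL.snd
    all_goals first | simp [Ty.WF, Ty.inst, oneL, addL, decL, maxL, Var.idx] | rfl
  all_goals simp [oneL, addL, decL, maxL, Var.idx]

theorem goRight_ty {K : Type} {γ : List Ent} (Γ : Ctx) :
    HasTyL Γ 0 [] (goRight : Tm K γ _)
      (.lolli (.tensor (.bang ⊤ 0 .key) (.tensor labT (.tensor labT
      (.tensor (.wth (.tree labT) (.tensor (.tree labT) (.tree labT)))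
      (.tensor (.wth (.tree labT) (.tensor (.tree labT) (.tree labT))) (.tree labT))))))
      (.tensor (.tree labT) (.tree labT))) := by
  unfold goRight
  apply HasTyL.toZero
  · repeat' first
      | exact HasTyL.var rfl
      | exact mk_ty _
      | with_reducible first
        | apply HasTyL.lam
        | apply HasTyL.app
        | apply HasTyL.letPair
        | apply HasTyL.save0
        | apply HasTyL.transfer0
        | apply HasTyL.transferV
        | apply HasTyL.unpackB
        | apply HasTyL.spend
        | apply HasTyL.ifLe
        | apply HasTyL.pair
        | apply HasTyL.fst
        | apply HasTyL.snd
    all_goals first | simp [Ty.WF, Ty.inst, oneL, addL, decL, maxL, Var.idx] | rfl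
  all_goals simp [oneL, addL, decL, maxL, Var.idx]

set_option maxHeartbeats 4000000 in
theorem split_ty {K : Type} {γ : List Ent} (Γ : Ctx) :
    HasTyL Γ 0 [] (split : Tm K γ _)
      (.lolli (.tensor (.bang ⊤ 0 .key) (.tree labT)) (.tensor (.tree labT) (.tree labT))) := by
  unfold split
  apply HasTyL.toZero
  · repeat' first
      | exact HasTyL.var rfl
      | exact goLeft_ty _
      | exact goRight_ty _
      | with_reducible first
        | apply HasTyL.lam
        | apply HasTyL.app
        | apply HasTyL.letPair
        | apply HasTyL.save0
        | apply HasTyL.saveV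
        | apply HasTyL.packV
        | apply HasTyL.transfer0
        | apply HasTyL.transferV
        | apply HasTyL.unpackB
        | apply HasTyL.tick
        | apply HasTyL.ifLe
        | apply HasTyL.pair
        | apply HasTyL.emp
        | apply HasTyL.node
        | apply HasTyL.fst
        | apply HasTyL.trec
    all_goals first | simp [Ty.WF, Ty.inst, oneL, addL, decL, maxL, Var.idx] | rfl
  all_goals simp [oneL, addL, decL, maxL, Var.idx]

/-- `split` is typable with an empty bank. -/
theorem split_hasTy {K : Type} : HasTy [] 0 (split : Tm K [] _)
    (.lolli (.tensor (.bang ⊤ 0 .key) (.tree labT)) (.tensor (.tree labT) (.tree labT))) :=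
  HasTy.weaken (split_ty []) ⟨le_rfl, fun i => by simp [Res.ofList]⟩

end SplayCost

/-! The bound is the potential argument for splay trees, the potential being the sum of φ(m) over
the sizes m of all subtrees, carried out inside the semantics. The cached sizes and stored credits
of a splay tree are functions of its shape, so its denotation is `enc τ` for a plain binary tree τ
of keys (`IsSplay.exists_enc`). On such encodings every program evaluates to an exact integer cost
and again to encodings; `ap_size` and `ap_mk` do this for reading sizes and building nodes.

The arithmetic core is `credits_add_credits_succ_le`: if m + k ≤ n and n > 0, then φ(m) + φ(k) + 1 ≤
2φ(n). Both terms are at most φ(n), and if both were equal to φ(n) = j + 1, then m and k would be at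
least 2^j, so that m + k ≥ 2^(j+1) > n. The gained 1 pays for the tick of one call.

Let a call on a tree of size N visit a child of size k and recurse into a grandchild of size a. Its
cost is 1 for the tick, minus φ(N) + φ(k) for the spent credits, plus at most 1 + 2φ(a) by
induction, plus the φ of the two new nodes. To stay below 1 + 2φ(N), one needs that 1 + 2φ(a) plus
the φ of the new nodes is at most 3φ(N) + φ(k). For an outer grandchild (`credits_outer`) one φ(a)
is absorbed by φ(k), the upper new node by φ(N), and the other φ(a) together with the lower new node
by the core inequality. For an inner grandchild (`credits_inner`) the two φ(a) are absorbed by φ(k)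
and φ(N), and the core inequality applies to the two new nodes.

Both estimates need the sizes of the two trees returned by the recursive call. The induction in
`exists_ap_split` therefore also proves that the results are encodings whose sizes add up to that of
the input. -/

namespace SplayCost

/-! # Evaluation of terms -/

section Eval

variable {K : Type} [LinearOrder K] {γ : List Ent} {a b c : STy}

/-- The environments of a context of `λᴬ`, after extraction. -/
abbrev TEnv (K : Type) [LinearOrder K] (γ : List Ent) : Type := Env K (γ.map Ent.pot)

/-- The denotation of the recurrence extracted from a term. -/
noncomputable def ev (M : Tm K γ a) (ρ : TEnv K γ) : WithTop ℤ × a.pot.den K := M.extract.den ρ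

/-- This constructor and the ones that follow are pairings, projections and constants up to
definitional unfolding. Their purpose is to keep every value at a type `a.pot.den K` with `a` a type
of `λᴬ`, so that rewriting matches syntactically and never has to unfold the interpretation of
types. -/
def econs (x : a.pot.den K) (ρ : TEnv K γ) : TEnv K (.tm a :: γ) := (x, ρ)

def econsC (x : Flat ℕ) (ρ : TEnv K γ) : TEnv K (.cred :: γ) := (x, ρ)

def enil : TEnv K [] := PUnit.unit

def lookC (x : Var γ .cred) (ρ : TEnv K γ) : Flat ℕ := (x.map Ent.pot).den ρ

/-- Adds a cost to a complexity. -/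
def charge {C : Type} (n : WithTop ℤ) (p : WithTop ℤ × C) : WithTop ℤ × C := (n + p.1, p.2)

def uv : STy.unit.pot.den K := PUnit.unit

def nv (n : ℕ) : STy.nat.pot.den K := Flat.val n

def kv (x : K) : STy.key.pot.den K := Flat.val x

def pr (x : a.pot.den K) (y : b.pot.den K) : (STy.tensor a b).pot.den K := (x, y)

def pr1 (p : (STy.tensor a b).pot.den K) : a.pot.den K := p.1

def pr2 (p : (STy.tensor a b).pot.den K) : b.pot.den K := p.2

def lazy (x : WithTop ℤ × a.pot.den K) (y : WithTop ℤ × b.pot.den K) :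
    (STy.wth a b).pot.den K := (x, y)

def lazy1 (p : (STy.wth a b).pot.den K) : WithTop ℤ × a.pot.den K := p.1

def lazy2 (p : (STy.wth a b).pot.den K) : WithTop ℤ × b.pot.den K := p.2

def ap (f : (STy.lolli a b).pot.den K) (x : a.pot.den K) : WithTop ℤ × b.pot.den K :=
  OrderHom.toFun (α := a.pot.den K) (β := (CTy.prod .cost b.pot).den K) f x

noncomputable def clo (M : Tm K (.tm a :: γ) b) (ρ : TEnv K γ) : (STy.lolli a b).pot.den K :=
  (ev (.lam M) ρ).2

/-- The form in which `CTm.stepNrec` hands a recursive result to the step function: a constant map,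
whose cost is incurred only when it is applied. -/
def thunk (x : WithTop ℤ × b.pot.den K) : (STy.lolli a b).pot.den K :=
  (OrderHom.const (a.pot.den K) x : a.pot.den K →o (CTy.prod .cost b.pot).den K)

def bv (x : a.pot.den K) : (STy.bang a).pot.den K := x

def unbv (x : (STy.bang a).pot.den K) : a.pot.den K := x

def exv (n : Flat ℕ) (x : a.pot.den K) : (STy.ex a).pot.den K := (n, x)

def ex1 (p : (STy.ex a).pot.den K) : Flat ℕ := p.1

def ex2 (p : (STy.ex a).pot.den K) : a.pot.den K := p.2

def temp : (STy.tree a).pot.den K := (TreeDom.emp : TreeDom (a.pot.den K) (Flat ℕ))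

def tnode (x : a.pot.den K) (n : STy.nat.pot.den K) (l r : (STy.tree a).pot.den K) :
    (STy.tree a).pot.den K := (TreeDom.node x n l r : TreeDom (a.pot.den K) (Flat ℕ))

def nsucc (n : STy.nat.pot.den K) : STy.nat.pot.den K := Flat.map (fun n => n + 1) n

noncomputable def crDen (e : Cr γ) (ρ : TEnv K γ) : Flat ℕ := (e.toCTm (K := K)).den ρ

/-- The branch selected by a comparison of keys. -/
def cmp : Flat K → Flat K → WithTop ℤ × a.pot.den K → WithTop ℤ × a.pot.den K →
    WithTop ℤ × a.pot.den K
  | .val x, .val y, p, q => if x ≤ y then p else q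
  | _, _, p, q => p ⊔ q

/-- The credit amount `n` as a cost. -/
noncomputable def credC : Flat ℕ →o WithTop ℤ := Flat.lift fun n : ℕ => (((n : ℕ) : ℤ) : WithTop ℤ)

/-- The credit amount `n` as a negative cost. -/
noncomputable def credN : Flat ℕ →o WithTop ℤ :=
  Flat.lift fun n : ℕ => ((-((n : ℕ) : ℤ) : ℤ) : WithTop ℤ)

/-- The recursion on numbers computed by `nrec`. -/
def nrecFn (f : (STy.lolli .unit c).pot.den K)
    (g : (STy.lolli (.tensor .nat (.lolli .unit c)) c).pot.den K) : ℕ → WithTop ℤ × c.pot.den K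
  | 0 => ap f uv
  | n + 1 => ap g (pr (nv n) (thunk (nrecFn f g n)))

/-- The recursion computed by `nrec`, on `ℕ ∪ {∞}`. -/
def nrecD (f : (STy.lolli .unit c).pot.den K)
    (g : (STy.lolli (.tensor .nat (.lolli .unit c)) c).pot.den K) :
    STy.nat.pot.den K → WithTop ℤ × c.pot.den K
  | .val n => nrecFn f g n
  | .inf => (⊤ : (CTy.prod .cost c.pot).den K)

/-- A subtree, lazily paired with a recursive result. -/
def sub (t : (STy.tree a).pot.den K) (r : WithTop ℤ × c.pot.den K) :
    (STy.wth (.tree a) c).pot.den K := lazy (0, t) r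

/-- The recursion on trees computed by `trec`. -/
def trecD (f₀ : (STy.lolli .unit c).pot.den K)
    (f₁ : (STy.lolli (.tensor a .nat) c).pot.den K)
    (f₂ f₃ : (STy.lolli (.tensor a (.tensor .nat (.tensor a (.tensor .nat
        (.tensor (.wth (.tree a) c) (.wth (.tree a) c)))))) c).pot.den K)
    (f₄ : (STy.lolli (.tensor a (.tensor .nat (.tensor a (.tensor .nat
        (.tensor (.wth (.tree a) c) (.tensor (.wth (.tree a) c) (.tensor a (.tensor .nat
        (.tensor (.wth (.tree a) c) (.wth (.tree a) c)))))))))) c).pot.den K)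
    (t : (STy.tree a).pot.den K) : WithTop ℤ × c.pot.den K :=
  TreeDom.rec₂ (α := a.pot.den K) (β := Flat ℕ) (C := (CTy.prod .cost c.pot).den K) (ap f₀ uv)
    (fun p => ap f₁ p)
    (fun p => ap f₂ (pr p.1 (pr p.2.1 (pr p.2.2.1 (pr p.2.2.2.1
      (pr (sub p.2.2.2.2.1.1 p.2.2.2.2.1.2) (sub p.2.2.2.2.2.1 p.2.2.2.2.2.2)))))))
    (fun p => ap f₃ (pr p.1 (pr p.2.1 (pr p.2.2.1 (pr p.2.2.2.1
      (pr (sub p.2.2.2.2.1.1 p.2.2.2.2.1.2) (sub p.2.2.2.2.2.1 p.2.2.2.2.2.2)))))))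
    (fun p => ap f₄ (pr p.1 (pr p.2.1 (pr p.2.2.1 (pr p.2.2.2.1
      (pr (sub p.2.2.2.2.1.1 p.2.2.2.2.1.2) (pr (sub p.2.2.2.2.2.1.1 p.2.2.2.2.2.1.2)
      (pr p.2.2.2.2.2.2.1 (pr p.2.2.2.2.2.2.2.1
      (pr (sub p.2.2.2.2.2.2.2.2.1.1 p.2.2.2.2.2.2.2.2.1.2)
        (sub p.2.2.2.2.2.2.2.2.2.1 p.2.2.2.2.2.2.2.2.2.2)))))))))))
    t

/-! ### Evaluation equations for the term constructors. -/

variable (ρ : TEnv K γ)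

@[simp] theorem ev_var_z (x : a.pot.den K) : ev (.var .z) (econs x ρ) = (0, x) := rfl

@[simp] theorem ev_var_s (v : Var γ (.tm a)) (x : b.pot.den K) :
    ev (.var (.s v)) (econs x ρ) = ev (.var v) ρ := rfl

@[simp] theorem ev_var_sC (v : Var γ (.tm a)) (x : Flat ℕ) :
    ev (.var (.s v)) (econsC x ρ) = ev (.var v) ρ := rfl

@[simp] theorem lookC_z (x : Flat ℕ) : lookC .z (econsC x ρ) = x := rfl

@[simp] theorem lookC_s (v : Var γ .cred) (x : b.pot.den K) :
    lookC (.s v) (econs x ρ) = lookC v ρ := rfl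

@[simp] theorem lookC_sC (v : Var γ .cred) (x : Flat ℕ) :
    lookC (.s v) (econsC x ρ) = lookC v ρ := rfl

@[simp] theorem crDen_const (n : ℕ) : crDen ⟨n, []⟩ ρ = .val n := rfl

@[simp] theorem crDen_single (n : ℕ) (x : Var γ .cred) :
    crDen ⟨n, [x]⟩ ρ = Flat.map (fun m => m + n) (lookC x ρ) := by
  change Flat.map₂ _ (lookC x ρ, .val n) = _
  cases lookC x ρ <;> rfl

@[simp] theorem flat_map_val (f : ℕ → ℕ) (n : ℕ) : Flat.map f (.val n) = .val (f n) := rfl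

@[simp] theorem credC_val (n : ℕ) : credC (.val n) = ((n : ℤ) : WithTop ℤ) := rfl

@[simp] theorem credN_val (n : ℕ) : credN (.val n) = ((-(n : ℤ) : ℤ) : WithTop ℤ) := rfl

@[simp] theorem ev_tick (M : Tm K γ a) : ev (.tick M) ρ = charge 1 (ev M ρ) := rfl

@[simp] theorem ev_create (e : Cr γ) (M : Tm K γ a) :
    ev (.create e M) ρ = charge (credC (crDen e ρ)) (ev M ρ) := rfl

@[simp] theorem ev_spend (e : Cr γ) (M : Tm K γ a) :
    ev (.spend e M) ρ = charge (credN (crDen e ρ)) (ev M ρ) := rfl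

@[simp] theorem ev_save (k : ℕ∞) (e : Cr γ) (M : Tm K γ a) :
    ev (.save k e M) ρ = (Sem.smul k (ev M ρ).1, bv (ev M ρ).2) := rfl

@[simp] theorem ev_transfer (k' k : ℕ∞) (e : Cr γ) (M : Tm K γ (.bang a))
    (N : Tm K (.tm a :: γ) c) :
    ev (.transfer k' k e M N) ρ =
      charge (Sem.smul k' (ev M ρ).1) (ev N (econs (unbv (ev M ρ).2) ρ)) := rfl

@[simp] theorem ev_unit : ev (.unit : Tm K γ _) ρ = (0, uv) := rfl

@[simp] theorem ev_pair (M : Tm K γ a) (N : Tm K γ b) :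
    ev (.pair M N) ρ = ((ev M ρ).1 + (ev N ρ).1, pr (ev M ρ).2 (ev N ρ).2) := rfl

@[simp] theorem ev_letPair (k : ℕ∞) (M : Tm K γ (.tensor a b)) (N : Tm K (.tm b :: .tm a :: γ) c) :
    ev (.letPair k M N) ρ = charge (Sem.smul k (ev M ρ).1)
      (ev N (econs (pr2 (ev M ρ).2) (econs (pr1 (ev M ρ).2) ρ))) := rfl

@[simp] theorem ev_lam (M : Tm K (.tm a :: γ) b) : ev (.lam M) ρ = (0, clo M ρ) := rfl

@[simp] theorem ap_clo (M : Tm K (.tm a :: γ) b) (x : a.pot.den K) :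
    ap (clo M ρ) x = ev M (econs x ρ) := rfl

@[simp] theorem ap_thunk (r : WithTop ℤ × b.pot.den K) (x : a.pot.den K) : ap (thunk r) x = r := rfl

@[simp] theorem ev_app (M : Tm K γ (.lolli a b)) (N : Tm K γ a) :
    ev (.app M N) ρ = charge ((ev M ρ).1 + (ev N ρ).1) (ap (ev M ρ).2 (ev N ρ).2) := rfl

@[simp] theorem ev_fst (M : Tm K γ (.wth a b)) :
    ev (.fst M) ρ = charge (ev M ρ).1 (lazy1 (ev M ρ).2) := rfl

@[simp] theorem ev_snd (M : Tm K γ (.wth a b)) :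
    ev (.snd M) ρ = charge (ev M ρ).1 (lazy2 (ev M ρ).2) := rfl

@[simp] theorem ev_zero : ev (.zero : Tm K γ _) ρ = (0, nv 0) := rfl

@[simp] theorem ev_succ (M : Tm K γ .nat) : ev (.succ M) ρ = ((ev M ρ).1, nsucc (ev M ρ).2) := rfl

-- Unlike most of the neighbouring equations this one is not definitional for a variable number: the
-- semantic recursor applies `CTm.stepNrec` at every step, whereas `nrecFn` wraps the recursive
-- result in `thunk` directly, so the two recursions are identified by induction on the number.
@[simp] theorem ev_nrec (M : Tm K γ .nat) (N₁ : Tm K γ (.lolli .unit c))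
    (N₂ : Tm K γ (.bang (.lolli (.tensor .nat (.lolli .unit c)) c))) :
    ev (.nrec M N₁ N₂) ρ = charge ((ev M ρ).1 + ((ev N₁ ρ).1 + (ev N₂ ρ).1))
      (nrecD (ev N₁ ρ).2 (unbv (ev N₂ ρ).2) (ev M ρ).2) := by
  have h : ∀ n : STy.nat.pot.den K, OrderHom.toFun (Sem.natRec (G := TEnv K γ)
        (C := (CTy.prod .cost c.pot).den K)
        (CTm.den (K := K) (.snd N₁.extract))
        (CTm.den (K := K) (a := .arr (.prod .nat (.prod .cost c.pot)) (.prod .cost c.pot))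
          (.app .stepNrec (.snd N₂.extract)))) (ρ, n) =
      nrecD (ev N₁ ρ).2 (unbv (ev N₂ ρ).2) n := by
    rintro (n | _)
    · induction n with
      | zero => rfl
      | succ n ih =>
        change _ = ap _ (pr _ (thunk (nrecD (ev N₁ ρ).2 (unbv (ev N₂ ρ).2) (.val n))))
        rw [← ih]
        rfl
    · rfl
  exact congrArg (charge _) (h _)

@[simp] theorem ev_key (x : K) : ev (.key x) ρ = (0, kv x) := rfl

@[simp] theorem ev_ifLe (M N : Tm K γ .key) (P Q : Tm K γ c) :
    ev (.ifLe M N P Q) ρ = charge ((ev M ρ).1 + (ev N ρ).1)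
      (cmp (ev M ρ).2 (ev N ρ).2 (ev P ρ) (ev Q ρ)) := by
  have h : ∀ k l : Flat K, (match k, l with
      | .val x, .val y => if x ≤ y then ev P ρ else ev Q ρ
      | _, _ => ev P ρ ⊔ ev Q ρ) = cmp k l (ev P ρ) (ev Q ρ) := by
    rintro (x | _) (y | _) <;> rfl
  exact congrArg (charge _) (h _ _)

@[simp] theorem ev_emp : ev (.emp : Tm K γ (.tree a)) ρ = (0, temp) := rfl

@[simp] theorem ev_node (M : Tm K γ a) (N : Tm K γ .nat) (L R : Tm K γ (.tree a)) :
    ev (.node M N L R) ρ = ((ev M ρ).1 + ((ev N ρ).1 + ((ev L ρ).1 + (ev R ρ).1)),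
      tnode (ev M ρ).2 (ev N ρ).2 (ev L ρ).2 (ev R ρ).2) := rfl

@[simp] theorem ev_trec (M : Tm K γ (.tree a))
    (N₀ : Tm K γ (.bang (.lolli .unit c)))
    (N₁ : Tm K γ (.bang (.lolli (.tensor a .nat) c)))
    (N₂ N₃ : Tm K γ (.bang (.lolli (.tensor a (.tensor .nat (.tensor a (.tensor .nat
        (.tensor (.wth (.tree a) c) (.wth (.tree a) c)))))) c)))
    (N₄ : Tm K γ (.bang (.lolli (.tensor a (.tensor .nat (.tensor a (.tensor .nat
        (.tensor (.wth (.tree a) c) (.tensor (.wth (.tree a) c) (.tensor a (.tensor .nat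
        (.tensor (.wth (.tree a) c) (.wth (.tree a) c)))))))))) c))) :
    ev (.trec M N₀ N₁ N₂ N₃ N₄) ρ = charge ((ev M ρ).1 + ((ev N₀ ρ).1 + ((ev N₁ ρ).1 +
        ((ev N₂ ρ).1 + ((ev N₃ ρ).1 + (ev N₄ ρ).1)))))
      (trecD (unbv (ev N₀ ρ).2) (unbv (ev N₁ ρ).2) (unbv (ev N₂ ρ).2) (unbv (ev N₃ ρ).2)
        (unbv (ev N₄ ρ).2) (ev M ρ).2) := rfl

@[simp] theorem ev_pack (e : Cr γ) (M : Tm K γ a) :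
    ev (.pack e M) ρ = ((ev M ρ).1, exv (crDen e ρ) (ev M ρ).2) := rfl

@[simp] theorem ev_unpack (M : Tm K γ (.ex a)) (N : Tm K (.tm a :: .cred :: γ) c) :
    ev (.unpack M N) ρ = charge (ev M ρ).1
      (ev N (econs (ex2 (ev M ρ).2) (econsC (ex1 (ev M ρ).2) ρ))) := rfl

@[simp] theorem charge_mk {C : Type} (m n : WithTop ℤ) (x : C) : charge m (n, x) = (m + n, x) := rfl

@[simp] theorem charge_zero {C : Type} (p : WithTop ℤ × C) : charge 0 p = p := by
  simp [charge]

-- The case `k = ⊤` is the one that matters: since ∞ · 0 = 0, saving a closure or a key for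
-- unboundedly many uses is free.
@[simp] theorem smul_zero' (k : ℕ∞) : Sem.smul k 0 = 0 := by
  change (if k = ⊤ then (if (0 : WithTop ℤ) ≤ 0 then 0 else ⊤) else k.toNat • 0) = (0 : WithTop ℤ)
  simp

@[simp] theorem smul_one' (n : WithTop ℤ) : Sem.smul 1 n = n := by
  simp [Sem.smul]

@[simp] theorem pr1_pr (x : a.pot.den K) (y : b.pot.den K) : pr1 (pr x y) = x := rfl

@[simp] theorem pr2_pr (x : a.pot.den K) (y : b.pot.den K) : pr2 (pr x y) = y := rfl

@[simp] theorem lazy1_sub (t : (STy.tree a).pot.den K) (r : WithTop ℤ × c.pot.den K) :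
    lazy1 (sub t r) = (0, t) := rfl

@[simp] theorem lazy2_sub (t : (STy.tree a).pot.den K) (r : WithTop ℤ × c.pot.den K) :
    lazy2 (sub t r) = r := rfl

@[simp] theorem unbv_bv (x : a.pot.den K) : unbv (bv x) = x := rfl

@[simp] theorem ex1_exv (n : Flat ℕ) (x : a.pot.den K) : ex1 (exv n x) = n := rfl

@[simp] theorem ex2_exv (n : Flat ℕ) (x : a.pot.den K) : ex2 (exv n x) = x := rfl

@[simp] theorem nsucc_nv (n : ℕ) : nsucc (nv n : STy.nat.pot.den K) = nv (n + 1) := rfl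

@[simp] theorem nrecD_nv (f : (STy.lolli .unit c).pot.den K)
    (g : (STy.lolli (.tensor .nat (.lolli .unit c)) c).pot.den K) (n : ℕ) :
    nrecD f g (nv n) = nrecFn f g n := rfl

@[simp] theorem cmp_pos {x y : K} (h : x ≤ y) (p q : WithTop ℤ × a.pot.den K) :
    cmp (kv x) (kv y) p q = p := if_pos h

@[simp] theorem cmp_neg {x y : K} (h : ¬ x ≤ y) (p q : WithTop ℤ × a.pot.den K) :
    cmp (kv x) (kv y) p q = q := if_neg h

/-! ### The two-level tree recursion on constructor trees. -/

section TreeRec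

variable (f₀ : (STy.lolli .unit c).pot.den K)
    (f₁ : (STy.lolli (.tensor a .nat) c).pot.den K)
    (f₂ f₃ : (STy.lolli (.tensor a (.tensor .nat (.tensor a (.tensor .nat
        (.tensor (.wth (.tree a) c) (.wth (.tree a) c)))))) c).pot.den K)
    (f₄ : (STy.lolli (.tensor a (.tensor .nat (.tensor a (.tensor .nat
        (.tensor (.wth (.tree a) c) (.tensor (.wth (.tree a) c) (.tensor a (.tensor .nat
        (.tensor (.wth (.tree a) c) (.wth (.tree a) c)))))))))) c).pot.den K)
    (x y z : a.pot.den K) (m n k : STy.nat.pot.den K) (s t u v : (STy.tree a).pot.den K)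

@[simp] theorem trecD_emp : trecD f₀ f₁ f₂ f₃ f₄ (temp : (STy.tree a).pot.den K) = ap f₀ uv := rfl

@[simp] theorem trecD_leaf : trecD f₀ f₁ f₂ f₃ f₄ (tnode x n temp temp) = ap f₁ (pr x n) := rfl

@[simp] theorem trecD_left : trecD f₀ f₁ f₂ f₃ f₄ (tnode x n (tnode y m s t) temp) =
    ap f₂ (pr x (pr n (pr y (pr m (pr (sub s (trecD f₀ f₁ f₂ f₃ f₄ s))
      (sub t (trecD f₀ f₁ f₂ f₃ f₄ t))))))) := rfl

@[simp] theorem trecD_right : trecD f₀ f₁ f₂ f₃ f₄ (tnode x n temp (tnode y m s t)) =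
    ap f₃ (pr x (pr n (pr y (pr m (pr (sub s (trecD f₀ f₁ f₂ f₃ f₄ s))
      (sub t (trecD f₀ f₁ f₂ f₃ f₄ t))))))) := rfl

@[simp] theorem trecD_both : trecD f₀ f₁ f₂ f₃ f₄ (tnode x n (tnode y m s t) (tnode z k u v)) =
    ap f₄ (pr x (pr n (pr y (pr m (pr (sub s (trecD f₀ f₁ f₂ f₃ f₄ s))
      (pr (sub t (trecD f₀ f₁ f₂ f₃ f₄ t)) (pr z (pr k (pr (sub u (trecD f₀ f₁ f₂ f₃ f₄ u))
        (sub v (trecD f₀ f₁ f₂ f₃ f₄ v))))))))))) := rfl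

end TreeRec

end Eval

/-- `IsSplay` speaks of the potential of a tree only. This supplies the other half, so that the
evaluation of a value is known completely: costs of components add up from 0, multiples of 0 are 0,
and functions and lazy pairs suspend their bodies. -/
theorem Tm.IsVal.ev_fst {K : Type} [LinearOrder K] {a : STy} {M : Tm K [] a} (h : M.IsVal) :
    (ev M enil).1 = 0 := by
  induction h with
  | unit | zero | key | lam | withPair | emp => rfl
  | succ _ ih | pack _ _ ih => exact ih
  | pair _ _ ih1 ih2 => rw [ev_pair, ih1, ih2, add_zero]
  | save _ _ _ ih => rw [ev_save, ih, smul_zero']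
  | node _ _ _ _ ih1 ih2 ih3 ih4 => rw [ev_node, ih1, ih2, ih3, ih4]; simp

/-! # Evaluation of the auxiliary programs -/

/-! ### Arithmetic of φ. -/

theorem credits_eq (n : ℕ) : credits n = Nat.clog 2 (n + 1) := by
  rw [credits, ← Real.natCeil_logb_natCast]
  push_cast
  rfl

theorem credits_zero : credits 0 = 0 := by simp [credits_eq]

/-- The Galois connection between φ and powers of two, through which the facts about φ below become
linear arithmetic in 2^k. -/
theorem credits_le_iff {n k : ℕ} : credits n ≤ k ↔ n + 1 ≤ 2 ^ k := by
  rw [credits_eq, Nat.clog_le_iff_le_pow one_lt_two]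

theorem lt_credits_iff {n k : ℕ} : k < credits n ↔ 2 ^ k < n + 1 := by
  rw [← not_le, credits_le_iff, not_le]

theorem credits_mono {m n : ℕ} (h : m ≤ n) : credits m ≤ credits n :=
  credits_le_iff.2 ((Nat.succ_le_succ h).trans (credits_le_iff.1 le_rfl))

theorem lt_two_pow_credits (n : ℕ) : n < 2 ^ credits n := credits_le_iff.1 le_rfl

/-- The slack 2^φ(n) - 1 - n counts how many further successors leave φ unchanged; the subtraction
is not truncated because n < 2^φ(n). If the slack is 0, then n + 1 is the full power 2^φ(n), so φ
jumps, and the new slack is 2^(φ(n)+1) - 1 - 2^φ(n) = n. This is why the loop of `phi` can restart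
its counter from the current index. -/
theorem credits_succ_of_eq {n : ℕ} (h : 2 ^ credits n - 1 - n = 0) :
    credits (n + 1) = credits n + 1 ∧ 2 ^ credits (n + 1) - 1 - (n + 1) = n := by
  have h1 := lt_two_pow_credits n
  have h2 : credits (n + 1) = credits n + 1 := by
    apply le_antisymm
    · rw [credits_le_iff, pow_succ]; omega
    · rw [Nat.succ_le_iff, lt_credits_iff]; omega
  refine ⟨h2, ?_⟩
  rw [h2, pow_succ]
  omega

/-- Positive slack: n + 2 ≤ 2^φ(n) still holds, so φ stays and one unit of slack is used up. -/
theorem credits_succ_of_lt {n j : ℕ} (h : 2 ^ credits n - 1 - n = j + 1) :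
    credits (n + 1) = credits n ∧ 2 ^ credits (n + 1) - 1 - (n + 1) = j := by
  have h2 : credits (n + 1) = credits n := by
    apply le_antisymm
    · rw [credits_le_iff]; omega
    · exact credits_mono (Nat.le_succ n)
  refine ⟨h2, ?_⟩
  rw [h2]
  omega

/-! ### Closed forms of the auxiliary programs. -/

section Programs

variable {K : Type} [LinearOrder K] {γ : List Ent} {a b c : STy} (ρ : TEnv K γ)

/-- A loop is evaluated by guessing its value `r n` after `n` steps; what is left are the base case
and one step. -/
theorem nrecFn_eq {f : (STy.lolli .unit c).pot.den K}
    {g : (STy.lolli (.tensor .nat (.lolli .unit c)) c).pot.den K}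
    (r : ℕ → WithTop ℤ × c.pot.den K) (h0 : ap f uv = r 0)
    (hs : ∀ n, ap g (pr (nv n) (thunk (r n))) = r (n + 1)) (n : ℕ) : nrecFn f g n = r n := by
  induction n with
  | zero => exact h0
  | succ n ih => rw [nrecFn, ih, hs]

@[simp] theorem ev_promote_fst : (ev promote ρ).1 = 0 := rfl

@[simp] theorem ap_promote (n : ℕ) : ap (ev promote ρ).2 (nv n) = (0, bv (nv n)) := by
  simp only [promote, ev_lam, ap_clo, ev_nrec, ev_var_z, nrecD_nv]
  rw [nrecFn_eq fun n => (0, bv (nv n))] <;> simp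

@[simp] theorem ev_plus_fst : (ev plus ρ).1 = 0 := rfl

@[simp] theorem ap_plus (m n : ℕ) : ap (ev plus ρ).2 (pr (nv m) (nv n)) = (0, nv (m + n)) := by
  simp [plus]
  rw [nrecFn_eq fun k => (0, nv (k + n))] <;> simp
  intro k
  rw [add_right_comm]

@[simp] theorem ev_phi_fst : (ev phi ρ).1 = 0 := rfl

@[simp] theorem ap_phi (n : ℕ) : ap (ev phi ρ).2 (nv n) = (0, nv (credits n)) := by
  simp [phi]
  -- The loop invariant: φ(k) together with its slack.
  rw [nrecFn_eq fun k => (0, pr (nv (credits k)) (nv (2 ^ credits k - 1 - k)))]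
  · simp
  · simp [credits_zero]
  · intro k
    -- The inner recursor of `phi` only tests whether the slack is zero, so its two cases are those
    -- of `credits_succ_of_eq` and `credits_succ_of_lt`.
    rcases h : 2 ^ credits k - 1 - k with _ | j
    · simp [nrecFn, (credits_succ_of_eq h).1, -tsub_le_iff_right]
      have := (credits_succ_of_eq h).2
      rw [(credits_succ_of_eq h).1] at this
      rw [this]
    · have := (credits_succ_of_lt h).2
      rw [(credits_succ_of_lt h).1] at this
      simp [nrecFn, (credits_succ_of_lt h).1, this]

@[simp] theorem ev_spawn_fst : (ev spawn ρ).1 = 0 := rfl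

-- Each iteration creates one credit and raises the packed amount by one, so the cost and the
-- witness of the existential grow together.
@[simp] theorem ap_spawn (n : ℕ) :
    ap (ev spawn ρ).2 (nv n) = (((n : ℤ) : WithTop ℤ), exv (.val n) (bv uv)) := by
  simp [spawn]
  rw [nrecFn_eq fun n => (((n : ℤ) : WithTop ℤ), exv (.val n) (bv uv))] <;> simp
  intro n
  rw [add_comm]

/-- The denotation of the splay tree with the given shape and keys. -/
noncomputable def enc : BinaryTree K → (STy.tree labS).pot.den K
  | .nil => temp
  | .node x l r =>
    tnode (exv (.val (credits (l.numNodes + r.numNodes + 1))) (bv (kv x)))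
      (nv (l.numNodes + r.numNodes + 1)) (enc l) (enc r)

@[simp] theorem ev_size_fst : (ev (size (a := a)) ρ).1 = 0 := rfl

-- The case distinction follows the five branches of the recursor. The branches take only the first
-- components of the lazy pairs, so no recursive result is ever charged and the cost is 0.
@[simp] theorem ap_size (t : BinaryTree K) :
    ap (ev size ρ).2 (enc t) = (0, pr (nv t.numNodes) (enc t)) := by
  rcases t with _ | ⟨x, _ | ⟨y, s, t⟩, _ | ⟨z, u, v⟩⟩
  · simp [size, enc]
  · simp [size, enc, BinaryTree.numNodes, trecD_leaf]
  · simp [size, enc, BinaryTree.numNodes, trecD_right]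
  · simp [size, enc, BinaryTree.numNodes, trecD_left]
  · simp [size, enc, BinaryTree.numNodes, trecD_both]

@[simp] theorem ev_mk_fst : (ev mk ρ).1 = 0 := rfl

-- The whole cost is that of `spawn`. Because the arguments are encodings, the sizes that are read
-- are correct, and so the result is again an encoding; this keeps the recursion of `split` within
-- the range of `enc`.
@[simp] theorem ap_mk (x : K) (l r : BinaryTree K) :
    ap (ev mk ρ).2 (pr (bv (kv x)) (pr (enc l) (enc r))) =
      (((credits (l.numNodes + r.numNodes + 1) : ℤ) : WithTop ℤ), enc (.node x l r)) := by
  simp [mk, enc]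

end Programs

/-! # Evaluation of `split` -/

/-! ### The inequalities behind the amortized bound. -/

/-- Two disjoint parts of a tree cannot both have the φ of the whole: at least one of them is at
most half as large. This integral form of the concavity of the logarithm yields the unit that pays
for a tick. -/
theorem credits_add_credits_succ_le {m k n : ℕ} (h : m + k ≤ n) (hn : 0 < n) :
    credits m + credits k + 1 ≤ 2 * credits n := by
  have hm : credits m ≤ credits n := credits_mono (by omega)
  have hk : credits k ≤ credits n := credits_mono (by omega)
  obtain ⟨j, hj⟩ : ∃ j, credits n = j + 1 :=
    Nat.exists_eq_succ_of_ne_zero (lt_credits_iff.2 (by simpa using hn)).ne'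
  -- Both terms are at most j + 1, so a failure forces both to equal j + 1, and then m and k are at
  -- least 2^j although n < 2^(j+1).
  by_contra h'
  have h1 : 2 ^ j < m + 1 := lt_credits_iff.1 (by omega)
  have h2 : 2 ^ j < k + 1 := lt_credits_iff.1 (by omega)
  have h3 := lt_two_pow_credits n
  rw [hj, pow_succ] at h3
  omega

/-- The potential balance when the recursive call is on an outer grandchild of size `a`. -/
theorem credits_outer {a b c g : ℕ} (h : g ≤ a) :
    1 + 2 * credits a + credits (b + c + 1) + credits (g + (b + c + 1) + 1) ≤
      3 * credits (a + b + 1 + c + 1) + credits (a + b + 1) := by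
  -- The outer grandchild and the lower new node are disjoint and omit one node of the whole tree.
  -- The other copy of `credits a` is covered by the visited child (`h3`), the upper new node by the
  -- old root (`h2`).
  have h1 : credits a + credits (b + c + 1) + 1 ≤ 2 * credits (a + b + 1 + c + 1) :=
    credits_add_credits_succ_le (by omega) (by omega)
  have h2 : credits (g + (b + c + 1) + 1) ≤ credits (a + b + 1 + c + 1) :=
    credits_mono (by omega)
  have h3 : credits a ≤ credits (a + b + 1) := credits_mono (by omega)
  omega

/-- The potential balance when the recursive call is on an inner grandchild of size `b`. -/
theorem credits_inner {a b c s g : ℕ} (h : s + g = b) :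
    1 + 2 * credits b + credits (a + s + 1) + credits (g + c + 1) ≤
      3 * credits (a + b + 1 + c + 1) + credits (a + b + 1) := by
  -- The two new nodes root disjoint trees whose sizes add up exactly to the size of the whole.
  have h1 : credits (a + s + 1) + credits (g + c + 1) + 1 ≤ 2 * credits (a + b + 1 + c + 1) :=
    credits_add_credits_succ_le (by omega) (by omega)
  have h2 : credits b ≤ credits (a + b + 1 + c + 1) := credits_mono (by omega)
  have h3 : credits b ≤ credits (a + b + 1) := credits_mono (by omega)
  omega

/-! ### Costs of the rotations and of the recursion. -/

section Split

variable {K : Type} [LinearOrder K] {γ : List Ent} (ρ : TEnv K γ)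

@[simp] theorem ev_goLeft_fst : (ev goLeft ρ).1 = 0 := rfl

variable {p x y : K} (α β : ℕ) (a s₁ g₁ b s₂ g₂ c : BinaryTree K) (n₁ n₂ : ℤ)

/-- The credits of the two visited keys enter negatively and each `mk` contributes the φ of its new
node. Both recursive results are present in the lazy pairs, but only the cost of the one that is
projected out is charged. -/
theorem ap_goLeft_pos (h : p ≤ y) :
    ap (ev goLeft ρ).2 (pr (bv (kv p)) (pr (exv (.val α) (bv (kv x))) (pr (exv (.val β) (bv (kv y)))
      (pr (sub (enc a) ((n₁ : WithTop ℤ), pr (enc s₁) (enc g₁)))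
      (pr (sub (enc b) ((n₂ : WithTop ℤ), pr (enc s₂) (enc g₂))) (enc c)))))) =
    (((-α - β + n₁ + credits (b.numNodes + c.numNodes + 1) +
      credits (g₁.numNodes + (b.numNodes + c.numNodes + 1) + 1) : ℤ) : WithTop ℤ),
      pr (enc s₁) (enc (.node y g₁ (.node x b c)))) := by
  simp [goLeft, cmp_pos h, sub_eq_add_neg, add_assoc]

theorem ap_goLeft_neg (h : ¬ p ≤ y) :
    ap (ev goLeft ρ).2 (pr (bv (kv p)) (pr (exv (.val α) (bv (kv x))) (pr (exv (.val β) (bv (kv y)))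
      (pr (sub (enc a) ((n₁ : WithTop ℤ), pr (enc s₁) (enc g₁)))
      (pr (sub (enc b) ((n₂ : WithTop ℤ), pr (enc s₂) (enc g₂))) (enc c)))))) =
    (((-α - β + n₂ + credits (a.numNodes + s₂.numNodes + 1) +
      credits (g₂.numNodes + c.numNodes + 1) : ℤ) : WithTop ℤ),
      pr (enc (.node y a s₂)) (enc (.node x g₂ c))) := by
  simp [goLeft, cmp_neg h, sub_eq_add_neg, add_assoc]

@[simp] theorem ev_goRight_fst : (ev goRight ρ).1 = 0 := rfl

theorem ap_goRight_pos (h : p ≤ y) :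
    ap (ev goRight ρ).2 (pr (bv (kv p)) (pr (exv (.val α) (bv (kv x)))
      (pr (exv (.val β) (bv (kv y)))
      (pr (sub (enc a) ((n₁ : WithTop ℤ), pr (enc s₁) (enc g₁)))
      (pr (sub (enc b) ((n₂ : WithTop ℤ), pr (enc s₂) (enc g₂))) (enc c)))))) =
    (((-α - β + n₁ + credits (c.numNodes + s₁.numNodes + 1) +
      credits (g₁.numNodes + b.numNodes + 1) : ℤ) : WithTop ℤ),
      pr (enc (.node x c s₁)) (enc (.node y g₁ b))) := by
  simp [goRight, cmp_pos h, sub_eq_add_neg, add_assoc]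

theorem ap_goRight_neg (h : ¬ p ≤ y) :
    ap (ev goRight ρ).2 (pr (bv (kv p)) (pr (exv (.val α) (bv (kv x)))
      (pr (exv (.val β) (bv (kv y)))
      (pr (sub (enc a) ((n₁ : WithTop ℤ), pr (enc s₁) (enc g₁)))
      (pr (sub (enc b) ((n₂ : WithTop ℤ), pr (enc s₂) (enc g₂))) (enc c)))))) =
    (((-α - β + n₂ + credits (c.numNodes + a.numNodes + 1) +
      credits (c.numNodes + a.numNodes + 1 + s₂.numNodes + 1) : ℤ) : WithTop ℤ),
      pr (enc (.node y (.node x c a) s₂)) (enc g₂)) := by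
  simp [goRight, cmp_neg h, sub_eq_add_neg, add_assoc]

/-- The inductive step of the amortized analysis: the hypotheses are the induction hypotheses for
the two grandchildren, and the 1 added to `n` in the conclusion is the tick charged by the branch of
`split` that calls `goLeft`. The quantifier over `ρ` lies inside because the program is closed, so
cost and results do not depend on the environment of that branch. The sizes `k` and `m` are
variables with equations so that they can be matched with sums in any order. -/
theorem exists_ap_goLeft {a b c s₁ g₁ s₂ g₂ : BinaryTree K} {n₁ n₂ : ℤ}
    (h₁ : s₁.numNodes + g₁.numNodes = a.numNodes) (h₂ : s₂.numNodes + g₂.numNodes = b.numNodes)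
    (hn₁ : n₁ ≤ 1 + 2 * (credits a.numNodes : ℤ)) (hn₂ : n₂ ≤ 1 + 2 * (credits b.numNodes : ℤ))
    (p x y : K) {k m : ℕ} (hk : k = a.numNodes + b.numNodes + 1)
    (hm : m = a.numNodes + b.numNodes + 1 + c.numNodes + 1) :
    ∃ (n : ℤ) (s g : BinaryTree K), (∀ {γ : List Ent} (ρ : TEnv K γ),
      ap (ev goLeft ρ).2 (pr (bv (kv p)) (pr (exv (.val (credits m)) (bv (kv x)))
        (pr (exv (.val (credits k)) (bv (kv y))) (pr (sub (enc a) (n₁, pr (enc s₁) (enc g₁)))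
        (pr (sub (enc b) (n₂, pr (enc s₂) (enc g₂))) (enc c)))))) =
        ((n : WithTop ℤ), pr (enc s) (enc g))) ∧
      s.numNodes + g.numNodes = m ∧ 1 + n ≤ 1 + 2 * (credits m : ℤ) := by
  subst hk hm
  by_cases h : p ≤ y
  · refine ⟨_, _, _, fun ρ => ap_goLeft_pos ρ _ _ a s₁ g₁ b s₂ g₂ c n₁ n₂ h, ?_, ?_⟩
    · simp only [BinaryTree.numNodes]; omega
    · have := credits_outer (b := b.numNodes) (c := c.numNodes) (g := g₁.numNodes)
        (h₁ ▸ Nat.le_add_left _ _)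
      omega
  · refine ⟨_, _, _, fun ρ => ap_goLeft_neg ρ _ _ a s₁ g₁ b s₂ g₂ c n₁ n₂ h, ?_, ?_⟩
    · simp only [BinaryTree.numNodes]; omega
    · have := credits_inner (a := a.numNodes) (c := c.numNodes) h₂
      omega

/-- The mirror image of `exists_ap_goLeft`: now the left subtree of the visited child is the inner
grandchild, so the case `p ≤ y` uses `credits_inner` and the other case `credits_outer`. -/
theorem exists_ap_goRight {a b c s₁ g₁ s₂ g₂ : BinaryTree K} {n₁ n₂ : ℤ}
    (h₁ : s₁.numNodes + g₁.numNodes = a.numNodes) (h₂ : s₂.numNodes + g₂.numNodes = b.numNodes)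
    (hn₁ : n₁ ≤ 1 + 2 * (credits a.numNodes : ℤ)) (hn₂ : n₂ ≤ 1 + 2 * (credits b.numNodes : ℤ))
    (p x y : K) {k m : ℕ} (hk : k = a.numNodes + b.numNodes + 1)
    (hm : m = a.numNodes + b.numNodes + 1 + c.numNodes + 1) :
    ∃ (n : ℤ) (s g : BinaryTree K), (∀ {γ : List Ent} (ρ : TEnv K γ),
      ap (ev goRight ρ).2 (pr (bv (kv p)) (pr (exv (.val (credits m)) (bv (kv x)))
        (pr (exv (.val (credits k)) (bv (kv y))) (pr (sub (enc a) (n₁, pr (enc s₁) (enc g₁)))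
        (pr (sub (enc b) (n₂, pr (enc s₂) (enc g₂))) (enc c)))))) =
        ((n : WithTop ℤ), pr (enc s) (enc g))) ∧
      s.numNodes + g.numNodes = m ∧ 1 + n ≤ 1 + 2 * (credits m : ℤ) := by
  subst hk hm
  by_cases h : p ≤ y
  · refine ⟨_, _, _, fun ρ => ap_goRight_pos ρ _ _ a s₁ g₁ b s₂ g₂ c n₁ n₂ h, ?_, ?_⟩
    · simp only [BinaryTree.numNodes]; omega
    · have := credits_inner (a := b.numNodes) (c := c.numNodes) ((add_comm _ _).trans h₁)
      -- The mirrored sizes are summed in a different order inside `credits`, whose values are atoms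
      -- for `omega`; normalizing the sums makes these atoms agree.
      simp only [add_comm, add_left_comm, add_assoc] at this hn₁ hn₂ ⊢
      omega
  · refine ⟨_, _, _, fun ρ => ap_goRight_neg ρ _ _ a s₁ g₁ b s₂ g₂ c n₁ n₂ h, ?_, ?_⟩
    · simp only [BinaryTree.numNodes]; omega
    · have := credits_outer (b := a.numNodes) (c := c.numNodes) (g := s₂.numNodes)
        (h₂ ▸ Nat.le_add_right _ _)
      simp only [add_comm, add_left_comm, add_assoc] at this hn₁ hn₂ ⊢
      omega

@[simp] theorem ev_split_fst : (ev split ρ).1 = 0 := rfl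

/-- Only the bound on `n` is wanted in the end. That the results are encodings and that sizes are
preserved is what the next level of the induction needs in order to compute the credits of its new
nodes. -/
theorem exists_ap_split (p : K) (t : BinaryTree K) :
    ∃ (n : ℤ) (s g : BinaryTree K),
      ap (ev split ρ).2 (pr (bv (kv p)) (enc t)) = ((n : WithTop ℤ), pr (enc s) (enc g)) ∧
      s.numNodes + g.numNodes = t.numNodes ∧ n ≤ 1 + 2 * (credits t.numNodes : ℤ) := by
  simp only [split, ev_lam, ap_clo, ev_letPair, ev_var_z, ev_var_s, smul_zero', charge_zero,
    pr1_pr, pr2_pr, ev_transfer, unbv_bv, ev_trec, ev_save, add_zero]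
  -- The closures of the branches were formed in an environment that contains the whole input tree,
  -- while the recursion descends with these same closures. Forgetting that part of the environment
  -- lets `t` vary in the induction; the pivot on top of it is kept.
  generalize econs (enc t) _ = σ
  -- The recursive calls are on grandchildren, hence strong induction on the size.
  induction hm : t.numNodes using Nat.strong_induction_on generalizing t with
  | _ m ih =>
  subst hm
  rcases t with _ | ⟨x, _ | ⟨y, a, b⟩, _ | ⟨z, u, v⟩⟩
  · exact ⟨1, .nil, .nil, by simp [enc], rfl, by simp⟩
  · by_cases hx : p ≤ x
    · exact ⟨1, .nil, .node x .nil .nil, by simp [enc, trecD_leaf, cmp_pos hx], rfl, by simp⟩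
    · exact ⟨1, .node x .nil .nil, .nil, by simp [enc, trecD_leaf, cmp_neg hx], rfl, by simp⟩
  · by_cases hx : p ≤ x
    · refine ⟨1, .nil, .node x .nil (.node z u v), ?_, by simp, by simp⟩
      simp [enc, trecD_right, cmp_pos hx]
    · obtain ⟨n₁, s₁, g₁, e₁, h₁, hn₁⟩ := ih u.numNodes (by simp; omega) u rfl
      obtain ⟨n₂, s₂, g₂, e₂, h₂, hn₂⟩ := ih v.numNodes (by simp; omega) v rfl
      obtain ⟨n, s, g, e, h, hn⟩ := exists_ap_goRight (c := .nil) h₁ h₂ hn₁ hn₂ p x z rfl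
        (m := (BinaryTree.node x .nil (.node z u v)).numNodes) (by simp)
      refine ⟨1 + n, s, g, ?_, h, hn⟩
      simp [enc] at e
      simp [enc, trecD_right, cmp_neg hx, e₁, e₂, e]
  · by_cases hx : p ≤ x
    · obtain ⟨n₁, s₁, g₁, e₁, h₁, hn₁⟩ := ih a.numNodes (by simp; omega) a rfl
      obtain ⟨n₂, s₂, g₂, e₂, h₂, hn₂⟩ := ih b.numNodes (by simp; omega) b rfl
      obtain ⟨n, s, g, e, h, hn⟩ := exists_ap_goLeft (c := .nil) h₁ h₂ hn₁ hn₂ p x y rfl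
        (m := (BinaryTree.node x (.node y a b) .nil).numNodes) (by simp)
      refine ⟨1 + n, s, g, ?_, h, hn⟩
      simp [enc] at e
      simp [enc, trecD_left, cmp_pos hx, e₁, e₂, e]
    · refine ⟨1, .node x (.node y a b) .nil, .nil, ?_, by simp, by simp⟩
      simp [enc, trecD_left, cmp_neg hx]
  · by_cases hx : p ≤ x
    · obtain ⟨n₁, s₁, g₁, e₁, h₁, hn₁⟩ := ih a.numNodes (by simp; omega) a rfl
      obtain ⟨n₂, s₂, g₂, e₂, h₂, hn₂⟩ := ih b.numNodes (by simp; omega) b rfl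
      obtain ⟨n, s, g, e, h, hn⟩ := exists_ap_goLeft (c := .node z u v) h₁ h₂ hn₁ hn₂ p x y rfl
        (m := (BinaryTree.node x (.node y a b) (.node z u v)).numNodes) (by simp)
      refine ⟨1 + n, s, g, ?_, h, hn⟩
      simp [enc] at e
      simp [enc, trecD_both, cmp_pos hx, e₁, e₂, e]
    · obtain ⟨n₁, s₁, g₁, e₁, h₁, hn₁⟩ := ih u.numNodes (by simp; omega) u rfl
      obtain ⟨n₂, s₂, g₂, e₂, h₂, hn₂⟩ := ih v.numNodes (by simp; omega) v rfl
      obtain ⟨n, s, g, e, h, hn⟩ := exists_ap_goRight (c := .node y a b) h₁ h₂ hn₁ hn₂ p x z rfl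
        (m := (BinaryTree.node x (.node y a b) (.node z u v)).numNodes) (by simp; omega)
      refine ⟨1 + n, s, g, ?_, h, hn⟩
      simp [enc] at e
      simp [enc, trecD_both, cmp_neg hx, e₁, e₂, e]

end Split

/-! ### From splay trees to encodings, and the bound. -/

/-- `IsSplay` rules out ∞ at every position and fixes sizes and credits from the shape; what remains
free is the shape and the keys, that is, a plain binary tree. -/
theorem IsSplay.exists_enc {K : Type} [LinearOrder K]
    (t : TreeDom (Flat ℕ × Flat K) (Flat ℕ)) (h : IsSplay t) :
    ∃ τ : BinaryTree K, t = (enc τ : (STy.tree labS).pot.den K) ∧ t.nodes = τ.numNodes := by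
  induction t with
  | inf => exact h.elim
  | emp => exact ⟨.nil, rfl, rfl⟩
  | node a n l r hl hr =>
    rcases a with ⟨α | _, x | _⟩ <;> rcases n with n | _ <;> try exact h.elim
    obtain ⟨h1, h2, -, -, h3, h4⟩ := h
    obtain ⟨σ, rfl, h5⟩ := hl h3
    obtain ⟨τ, rfl, h6⟩ := hr h4
    rw [h5, h6] at h1
    subst h1 h2
    exact ⟨.node x σ τ, rfl, by simp [TreeDom.nodes, h5, h6]⟩

theorem Tm.costDen_eq {K : Type} [LinearOrder K] {a : STy} (M : Tm K [] a) :
    M.costDen = (ev M enil).1 := rfl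

theorem Tm.potDen_eq {K : Type} [LinearOrder K] {a : STy} (M : Tm K [] a) :
    M.potDen = (ev M enil).2 := rfl

theorem sizeDen_eq {K : Type} [LinearOrder K] (t : Tm K [] (.tree labS)) :
    sizeDen t = pr1 (a := .nat) (b := .tree labS) (ev (.app size t) enil).2 :=
  congrArg (pr1 (a := .nat) (b := .tree labS)) (Tm.potDen_eq _)

/-- The size of a splay tree, and the amortized cost of splitting it. -/
theorem sizeDen_and_costDen_splitAt_le {K : Type} [LinearOrder K] {t : Tm K [] (.tree labS)}
    (v : K) (ht : t.IsVal) (hs : IsSplay (K := K) t.potDen) :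
    sizeDen t = .val (TreeDom.nodes (t.potDen : TreeDom (Flat ℕ × Flat K) (Flat ℕ))) ∧
      (splitAt t v).costDen ≤ 1 + 2 • creditsDen (sizeDen t) := by
  obtain ⟨τ, h1, h2⟩ := IsSplay.exists_enc _ hs
  -- The cost component comes from `t` being a value, the potential from the encoding.
  have hev : ev t enil = (0, enc τ) := Prod.ext ht.ev_fst h1
  have hsize : sizeDen t = .val τ.numNodes := by
    rw [sizeDen_eq, ev_app, hev, ap_size]
    rfl
  refine ⟨hsize.trans (congrArg Flat.val h2.symm), ?_⟩
  obtain ⟨n, s, g, h, -, hc⟩ := exists_ap_split enil v τ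
  have hcost : (splitAt t v).costDen = n := by
    rw [Tm.costDen_eq]
    simp [splitAt, hev, h]
  rw [hcost, hsize, two_nsmul]
  rw [two_mul] at hc
  -- All quantities are finite, so the inequality descends from `WithTop ℤ` to `ℤ`.
  change (n : WithTop ℤ) ≤ 1 + (((credits τ.numNodes : ℤ) : WithTop ℤ) +
    ((credits τ.numNodes : ℤ) : WithTop ℤ))
  exact_mod_cast hc

/-! ### Logarithmic growth of the bound. -/

theorem isBigO_credits :
    (fun n : ℕ => (1 : ℝ) + 2 * (credits n : ℝ)) =O[Filter.atTop]
      fun n : ℕ => Real.logb 2 (n : ℝ) := by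
  -- With L = lg n ≥ 1 for n ≥ 2, one has lg (n + 1) ≤ L + 1 because n + 1 ≤ 2n, so the ceiling is
  -- below L + 2 and 1 + 2(L + 2) = 2L + 5 ≤ 7L.
  refine Asymptotics.IsBigO.of_bound 7 ?_
  filter_upwards [Filter.eventually_ge_atTop 2] with n hn
  have h2 : (2 : ℝ) ≤ n := by exact_mod_cast hn
  have h1 : (1 : ℝ) ≤ Real.logb 2 n := by
    rw [Real.le_logb_iff_rpow_le one_lt_two (by positivity)]
    simpa
  have h3 : Real.logb 2 ((n : ℝ) + 1) ≤ Real.logb 2 n + 1 := by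
    rw [Real.logb_le_iff_le_rpow one_lt_two (by positivity), Real.rpow_add two_pos,
      Real.rpow_logb two_pos (by norm_num) (by positivity), Real.rpow_one]
    linarith
  have h4 : (credits n : ℝ) < Real.logb 2 ((n : ℝ) + 1) + 1 :=
    Nat.ceil_lt_add_one (Real.logb_nonneg one_lt_two (by linarith))
  rw [Real.norm_of_nonneg (by positivity), Real.norm_of_nonneg (by positivity)]
  linarith

end SplayCost

theorem mainTheorem5 {K : Type} [LinearOrder K] :
    (∀ (t : SplayCost.Tm K [] (.tree SplayCost.labS)) (a : ℕ∞) (n : ℕ) (v : K),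
      t.IsVal → SplayCost.HasTy [] (a, 0) t (.tree SplayCost.labT) →
      SplayCost.IsSplay (K := K) t.potDen →
      SplayCost.TreeDom.nodes
        (t.potDen : SplayCost.TreeDom (SplayCost.Flat ℕ × SplayCost.Flat K) (SplayCost.Flat ℕ)) = n →
      SplayCost.sizeDen t = .val n ∧
      (SplayCost.splitAt t v).costDen ≤
        1 + 2 • SplayCost.creditsDen (SplayCost.sizeDen t)) ∧
    (fun n : ℕ => (1 : ℝ) + 2 * (SplayCost.credits n : ℝ)) =O[Filter.atTop]
      fun n : ℕ => Real.logb 2 (n : ℝ) := by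
  exact ⟨fun t _ n v ht _ hs hn => hn ▸ SplayCost.sizeDen_and_costDen_splitAt_le v ht hs,
    SplayCost.isBigO_credits⟩
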